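/- All vertex operator algebras (VOAs) are over $\mathbb C$; write $Y(a,z)=\sum_{n\in\mathbb Z}a_nz^{-n-1}$ and $L(n)=\omega_{n+1}$. Let $(V,Y,\mathbf 1,\omega)$ be a VOA of CFT-type, i.e. $V=\bigoplus_{n\ge 0}V_n$ and $V_0=\mathbb C\mathbf 1\neq 0$. Assume that $V$ is unitary: there are an anti-linear involution $\phi$ of $V$ (with $\phi(\mathbf 1)=\mathbf 1$, $\phi(\omega)=\omega$, $\phi(a_nb)=\phi(a)_n\phi(b)$) and a positive-definite Hermitian form $(\cdot,\cdot)$ on $V$ with $(Y(e^{zL(1)}(-z^{-2})^{L(0)}a,z^{-1})u,v)=(u,Y(\phi(a),z)v)$. Assume that there is a non-split extension of (weak) $V$-modules $$0\to V\xrightarrow{\ \iota\ }\tilde V\xrightarrow{\ \psi\ }V\to 0 .$$ Then the following hold. (1) The vacuum $\mathbf 1$ has an inverse image under $\psi$ in the generalized eigenspace $\tilde V_{[0]}$ of $L(0)$ with eigenvalue $0$. For every such inverse image $\tilde{\mathbf 1}$ there is $u\in V$ with $\iota(u)=L(-1)\tilde{\mathbf 1}$, and there is an element $w\in\mathbb C(u+\phi(u))\cup\mathbb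 C(u-\phi(u))$ normalized by $w_1w=\mathbf 1$. (2) For every such $w$: $w$ lies in the centre of the Lie algebra $V_1$ (with bracket $[a,b]=a_0b$); the vertex subalgebra $\mathrm{VA}(w)$ of $V$ generated by $w$, with conformal vector $\omega^1=\tfrac12w_{-1}w$, is a VOA isomorphic to the rank-one Heisenberg (free boson) VOA $M(1)$; $\omega-\omega^1$ lies in the commutant $\mathrm{Com}(\mathrm{VA}(w),V)=\{v\in V\mid \alpha_nv=0\text{ for all }\alpha\in\mathrm{VA}(w),\ n\ge 0\}$, which is a VOA with conformal vector $\omega-\omega^1$; and $a\otimes b\mapsto a_{-1}b$ is an isomorphism of VOAs $$\mathrm{VA}(w)\otimes\mathrm{Com}(\mathrm{VA}(w),V)\;\cong\;V .$$ (3) $V$ is not holomorphic, i.e. it is not the case that $V$ is simple and every simple $\mathbb N$-gradable $V$-module is isomorphic to $V$. Here a $V$-module $M$ is $\mathbb N$-gradable if $M=\bigoplus_{n\ge0}M_{(n)}$ with $a_mM_{(n)}\subseteq M_{(n+k-m-1)}$ for $a\in V_k$ and all $m\in\mathbb Z$, $n\ge 0$ (where $M_{(j)}=0$ for $j<0$).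 -/

import Mathlib

open scoped TensorProduct

noncomputable section

namespace VOA

/-! ### Fields and their modes -/

section Fields

variable {U M N P : Type*} [AddCommGroup U] [Module ℂ U] [AddCommGroup M] [Module ℂ M]
  [AddCommGroup N] [Module ℂ N] [AddCommGroup P] [Module ℂ P]

/-- The modes of a map `Y : U → Hom(M, M((z)))`: writing `Y(a, z) = ∑ a_n z^{-n-1}`,
`mode Y n a x` is `a_n x`. -/
def mode (Y : U →ₗ[ℂ] VertexOperator ℂ M) (n : ℤ) : U →ₗ[ℂ] M →ₗ[ℂ] M where
  toFun a := VertexOperator.ncoeff (Y a) n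
  map_add' a b := by simp
  map_smul' c a := by simp

/-- A field `∑ f_n z^{-n-1}` from its modes `f_n`. -/
def fieldOfModes (f : ℤ → Module.End ℂ M) (hf : ∀ x, ∃ N : ℤ, ∀ n, N ≤ n → f n x = 0) :
    VertexOperator ℂ M :=
  VertexOperator.of_coeff (fun n => f (-n - 1)) (by
    intro x
    obtain ⟨N, hN⟩ := hf x
    refine ⟨-N, fun n hn => ?_⟩
    by_contra hlt
    exact hn (hN _ (by omega)))

theorem ncoeff_fieldOfModes (f : ℤ → Module.End ℂ M)
    (hf : ∀ x, ∃ N : ℤ, ∀ n, N ≤ n → f n x = 0) (n : ℤ) :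
    VertexOperator.ncoeff (fieldOfModes f hf) n = f n := by
  rw [fieldOfModes, VertexOperator.ncoeff_of_coeff]
  congr 1
  omega

theorem field_ext {A B : VertexOperator ℂ M}
    (h : ∀ n, VertexOperator.ncoeff A n = VertexOperator.ncoeff B n) : A = B := by
  apply HVertexOperator.coeff_inj
  funext n
  have := h (-n - 1)
  rw [VertexOperator.ncoeff_apply, VertexOperator.ncoeff_apply] at this
  have e : -(-n - 1) - 1 = n := by ring
  rwa [e] at this

theorem field_truncation (A : VertexOperator ℂ M) (x : M) :
    ∃ N : ℤ, ∀ n, N ≤ n → VertexOperator.ncoeff A n x = 0 :=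
  ⟨-HahnSeries.order ((HahnModule.of ℂ).symm (A x)), fun n hn =>
    VertexOperator.ncoeff_eq_zero_of_lt_order A n x (by omega)⟩

theorem mode_truncation (Y : U →ₗ[ℂ] VertexOperator ℂ M) (a : U) (x : M) :
    ∃ N : ℤ, ∀ n, N ≤ n → mode Y n a x = 0 :=
  field_truncation (Y a) x

/-- The map `Y(·, z)` from its modes. -/
def ofModes (f : ℤ → U →ₗ[ℂ] M →ₗ[ℂ] M)
    (hf : ∀ a x, ∃ N : ℤ, ∀ n, N ≤ n → f n a x = 0) : U →ₗ[ℂ] VertexOperator ℂ M where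
  toFun a := fieldOfModes (fun n => f n a) (hf a)
  map_add' a b := field_ext fun n => by
    simp only [map_add, Pi.add_apply, ncoeff_fieldOfModes]
  map_smul' c a := field_ext fun n => by
    simp only [map_smul, Pi.smul_apply, ncoeff_fieldOfModes, RingHom.id_apply]

theorem mode_ofModes (f : ℤ → U →ₗ[ℂ] M →ₗ[ℂ] M)
    (hf : ∀ a x, ∃ N : ℤ, ∀ n, N ≤ n → f n a x = 0) (n : ℤ) : mode (ofModes f hf) n = f n := by
  ext1 a
  exact ncoeff_fieldOfModes (fun n => f n a) (hf a) n

/-- The sum of a pointwise finite family of linear maps. -/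
def sumLin {ι : Type*} (f : ι → M →ₗ[ℂ] N)
    (hf : ∀ x, (Function.support fun i => f i x).Finite) : M →ₗ[ℂ] N where
  toFun x := ∑ᶠ i, f i x
  map_add' x y := by
    simp only [map_add]
    exact finsum_add_distrib (hf x) (hf y)
  map_smul' c x := by
    simp only [map_smul, RingHom.id_apply]
    exact (smul_finsum' c (hf x)).symm

/-- The sum of a pointwise finite family of bilinear maps. -/
def sumBilin {ι : Type*} (f : ι → M →ₗ[ℂ] N →ₗ[ℂ] P)
    (hf : ∀ x y, (Function.support fun i => f i x y).Finite) : M →ₗ[ℂ] N →ₗ[ℂ] P where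
  toFun x := sumLin (fun i => f i x) (hf x)
  map_add' x x' := by
    ext y
    change ∑ᶠ i, f i (x + x') y = (∑ᶠ i, f i x y) + ∑ᶠ i, f i x' y
    simp only [map_add, LinearMap.add_apply]
    exact finsum_add_distrib (hf x y) (hf x' y)
  map_smul' c x := by
    ext y
    change ∑ᶠ i, f i (c • x) y = c • ∑ᶠ i, f i x y
    simp only [map_smul, LinearMap.smul_apply]
    exact (smul_finsum' c (hf x y)).symm

end Fields

/-! ### Vertex operator algebras -/

/-- The data of a vertex operator algebra on the complex vector space `V`: the state-field map,
the vacuum and the conformal vector.  The axioms are in `PreVOA.IsVOA`. -/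
structure PreVOA (V : Type*) [AddCommGroup V] [Module ℂ V] where
  /-- `a ↦ Y(a, z)` -/
  Y : V →ₗ[ℂ] VertexOperator ℂ V
  /-- the vacuum `𝟏` -/
  vac : V
  /-- the conformal vector `ω` -/
  conf : V

section Modules

variable {V M M' : Type*} [AddCommGroup V] [Module ℂ V] [AddCommGroup M] [Module ℂ M]
  [AddCommGroup M'] [Module ℂ M']

/-- The Borcherds identity (the Jacobi identity in components) for operators `Y(a, z)` on `M`,
`a ∈ V`:
`∑_i C(m,i) (a_{l+i} b)_{m+n-i} x
  = ∑_i (-1)^i C(l,i) (a_{m+l-i} b_{n+i} x - (-1)^l b_{n+l-i} a_{m+i} x)`.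
All sums are finite, because all fields are truncated. -/
def PreVOA.Borcherds (A : PreVOA V) (Y : V →ₗ[ℂ] VertexOperator ℂ M) : Prop :=
  ∀ (a b : V) (x : M) (l m n : ℤ),
    ∑ᶠ i : ℕ, Ring.choose m i • mode Y (m + n - i) (mode A.Y (l + i) a b) x =
      ∑ᶠ i : ℕ, ((-1) ^ i * Ring.choose l i) •
        (mode Y (m + l - i) a (mode Y (n + i) b x) -
          ((Int.negOnePow l : ℤˣ) : ℤ) • mode Y (n + l - i) b (mode Y (m + i) a x))

/-- `Y(𝟏, z)` is the identity of `M`. -/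
def PreVOA.VacuumActsAsId (A : PreVOA V) (Y : V →ₗ[ℂ] VertexOperator ℂ M) : Prop :=
  ∀ (n : ℤ) (x : M), mode Y n A.vac x = if n = -1 then x else 0

/-- `(M, Y)` is a (weak) module for the vertex algebra `A`. -/
structure PreVOA.IsModule (A : PreVOA V) (Y : V →ₗ[ℂ] VertexOperator ℂ M) : Prop where
  vacuum : A.VacuumActsAsId Y
  borcherds : A.Borcherds Y

/-- `f` is a homomorphism of modules. -/
def IsHom (Y : V →ₗ[ℂ] VertexOperator ℂ M) (Y' : V →ₗ[ℂ] VertexOperator ℂ M')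
    (f : M →ₗ[ℂ] M') : Prop :=
  ∀ (a : V) (n : ℤ) (x : M), f (mode Y n a x) = mode Y' n a (f x)

/-- The module `(M, Y)` is simple: it is nonzero, and its only submodules are `0` and `M`. -/
def IsSimple (Y : V →ₗ[ℂ] VertexOperator ℂ M) : Prop :=
  Nontrivial M ∧ ∀ S : Submodule ℂ M,
    (∀ (a : V) (n : ℤ), ∀ x ∈ S, mode Y n a x ∈ S) → S = ⊥ ∨ S = ⊤

/-- `0 → M₁ → M → M₂ → 0`, with maps `ι` and `ψ`, is a non-split extension of modules. -/
structure IsNonsplitExtension {M₁ M₂ : Type*} [AddCommGroup M₁] [Module ℂ M₁]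
    [AddCommGroup M₂] [Module ℂ M₂] (Y₁ : V →ₗ[ℂ] VertexOperator ℂ M₁)
    (Y : V →ₗ[ℂ] VertexOperator ℂ M) (Y₂ : V →ₗ[ℂ] VertexOperator ℂ M₂)
    (ι : M₁ →ₗ[ℂ] M) (ψ : M →ₗ[ℂ] M₂) : Prop where
  hom_left : IsHom Y₁ Y ι
  hom_right : IsHom Y Y₂ ψ
  injective : Function.Injective ι
  surjective : Function.Surjective ψ
  exact : LinearMap.range ι = LinearMap.ker ψ
  nonsplit : ¬ ∃ s : M₂ →ₗ[ℂ] M, IsHom Y₂ Y s ∧ ψ ∘ₗ s = LinearMap.id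

end Modules

namespace PreVOA

variable {V : Type*} [AddCommGroup V] [Module ℂ V]

/-- The Virasoro operator `L(n) = ω_{n+1}` on a module. -/
def virasoroOn (A : PreVOA V) {M : Type*} [AddCommGroup M] [Module ℂ M]
    (Y : V →ₗ[ℂ] VertexOperator ℂ M) (n : ℤ) : Module.End ℂ M :=
  mode Y (n + 1) A.conf

/-- The Virasoro operator `L(n)` on the algebra itself. -/
def L (A : PreVOA V) (n : ℤ) : Module.End ℂ V := A.virasoroOn A.Y n

/-- `V_n`, the eigenspace of `L(0)` with eigenvalue `n`. -/
def weight (A : PreVOA V) (n : ℤ) : Submodule ℂ V := Module.End.eigenspace (A.L 0) (n : ℂ)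

/-- The axioms of a vertex algebra. -/
structure IsVertexAlgebra (A : PreVOA V) : Prop where
  vacuum : A.VacuumActsAsId A.Y
  creation : ∀ a : V, mode A.Y (-1) a A.vac = a
  creation_nonneg : ∀ (a : V) (n : ℤ), 0 ≤ n → mode A.Y n a A.vac = 0
  borcherds : A.Borcherds A.Y

/-- The axioms of a vertex operator algebra. -/
structure IsVOA (A : PreVOA V) : Prop extends IsVertexAlgebra A where
  virasoro : ∃ c : ℂ, ∀ m n : ℤ, A.L m * A.L n - A.L n * A.L m =
    ((m : ℂ) - n) • A.L (m + n) +
      (if m + n = 0 then c * ((m : ℂ) ^ 3 - m) / 12 else 0) • (1 : Module.End ℂ V)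
  derivative : ∀ (a : V) (n : ℤ), mode A.Y n (A.L (-1) a) = -(n : ℂ) • mode A.Y (n - 1) a
  grading : DirectSum.IsInternal A.weight
  finite : ∀ n, FiniteDimensional ℂ (A.weight n)
  bounded : ∃ N : ℤ, ∀ n < N, A.weight n = ⊥

/-- CFT-type: `V = ⨁_{n ≥ 0} V_n` and `V_0 = ℂ𝟏 ≠ 0`. -/
structure IsCFTType (A : PreVOA V) : Prop where
  weight_neg : ∀ n < 0, A.weight n = ⊥
  weight_zero : A.weight 0 = Submodule.span ℂ {A.vac}
  vac_ne_zero : A.vac ≠ 0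

/-- The module `(M, Y)` is `ℕ`-gradable: `M = ⨁_{n ∈ ℕ} M_(n)` with
`a_m M_(n) ⊆ M_(n + wt a - m - 1)`, where `M_(k) = 0` for `k < 0`. -/
def IsNGradable (A : PreVOA V) {M : Type*} [AddCommGroup M] [Module ℂ M]
    (Y : V →ₗ[ℂ] VertexOperator ℂ M) : Prop :=
  ∃ G : ℤ → Submodule ℂ M, (∀ k < 0, G k = ⊥) ∧ DirectSum.IsInternal G ∧
    ∀ (k m n : ℤ), ∀ a ∈ A.weight k, ∀ x ∈ G n, mode Y m a x ∈ G (n + k - m - 1)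

/-- Holomorphic: `V` is a simple module over itself and, up to isomorphism, it is the only simple
`ℕ`-gradable `V`-module. -/
def IsHolomorphic.{u} {V : Type u} [AddCommGroup V] [Module ℂ V] (A : PreVOA V) : Prop :=
  IsSimple A.Y ∧
    ∀ (M : Type u) [AddCommGroup M] [Module ℂ M] (Y : V →ₗ[ℂ] VertexOperator ℂ M),
      A.IsModule Y → A.IsNGradable Y → IsSimple Y →
        ∃ f : M ≃ₗ[ℂ] V, IsHom Y A.Y (f : M →ₗ[ℂ] V)

/-- A unitary structure: an anti-linear involution `φ` and a positive-definite Hermitian form,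
linear in the first variable, such that
`(Y(e^{zL(1)} (-z^{-2})^{L(0)} a, z⁻¹) u, v) = (u, Y(φ(a), z) v)`.
The field `invariant` is the coefficient of `z^{-m-1}` of this identity for `a ∈ V_k`. -/
structure UnitaryStructure (A : PreVOA V) where
  /-- the anti-linear involution -/
  φ : V →ₛₗ[starRingEnd ℂ] V
  /-- the Hermitian form -/
  form : V →ₗ[ℂ] V →ₛₗ[starRingEnd ℂ] ℂ
  φ_φ : ∀ v, φ (φ v) = v
  φ_vac : φ A.vac = A.vac
  φ_conf : φ A.conf = A.conf
  φ_mode : ∀ (n : ℤ) (u v : V), φ (mode A.Y n u v) = mode A.Y n (φ u) (φ v)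
  hermitian : ∀ u v, form u v = starRingEnd ℂ (form v u)
  posDef : ∀ v, v ≠ 0 → 0 < (form v v).re
  invariant : ∀ (k m : ℤ), ∀ a ∈ A.weight k, ∀ u v : V,
    ∑ᶠ j : ℕ, (-1 : ℂ) ^ k * (j.factorial : ℂ)⁻¹ *
        form (mode A.Y (2 * k - m - j - 2) (((A.L 1) ^ j) a) u) v =
      form u (mode A.Y m (φ a) v)

/-- An isomorphism of vertex operator algebras. -/
structure IsVOAIso {W : Type*} [AddCommGroup W] [Module ℂ W] (A : PreVOA V) (B : PreVOA W)
    (f : V ≃ₗ[ℂ] W) : Prop where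
  map_vac : f A.vac = B.vac
  map_conf : f A.conf = B.conf
  map_mode : ∀ (n : ℤ) (a b : V), f (mode A.Y n a b) = mode B.Y n (f a) (f b)

/-- `w` lies in the centre of the Lie algebra `V_1`, whose bracket is `[a, b] = a_0 b`. -/
def IsCentral (A : PreVOA V) (w : V) : Prop :=
  w ∈ A.weight 1 ∧ ∀ v ∈ A.weight 1, mode A.Y 0 w v = 0

/-! ### Vertex subalgebras -/

/-- `S` is a vertex subalgebra. -/
structure IsSubVA (A : PreVOA V) (S : Submodule ℂ V) : Prop where
  vac_mem : A.vac ∈ S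
  mode_mem : ∀ (n : ℤ), ∀ a ∈ S, ∀ b ∈ S, mode A.Y n a b ∈ S

/-- A vertex subalgebra, with the conformal vector `ω'`. -/
def sub (A : PreVOA V) (S : Submodule ℂ V) (hS : A.IsSubVA S) (ω' : V) (hω : ω' ∈ S) :
    PreVOA S where
  Y := ofModes
    (fun n => LinearMap.mk₂ ℂ (fun a b : S => (⟨mode A.Y n a b, hS.mode_mem n a a.2 b b.2⟩ : S))
      (fun _ _ _ => by ext; simp) (fun _ _ _ => by ext; simp)
      (fun _ _ _ => by ext; simp) (fun _ _ _ => by ext; simp))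
    (fun a x => by
      obtain ⟨N, hN⟩ := mode_truncation A.Y (a : V) (x : V)
      exact ⟨N, fun n hn => Subtype.ext (hN n hn)⟩)
  vac := ⟨A.vac, hS.vac_mem⟩
  conf := ⟨ω', hω⟩

theorem mode_sub (A : PreVOA V) (S : Submodule ℂ V) (hS : A.IsSubVA S) (ω' : V) (hω : ω' ∈ S)
    (n : ℤ) (a b : S) : ((mode (A.sub S hS ω' hω).Y n a b : S) : V) = mode A.Y n (a : V) b := by
  simp [sub, mode_ofModes]

/-- `VA(w)`, the vertex subalgebra generated by `w`. -/
def VA (A : PreVOA V) (w : V) : Submodule ℂ V := sInf {S | A.IsSubVA S ∧ w ∈ S}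

theorem mem_VA (A : PreVOA V) (w : V) : w ∈ A.VA w :=
  Submodule.mem_sInf.2 fun _ hS => hS.2

theorem isSubVA_VA (A : PreVOA V) (w : V) : A.IsSubVA (A.VA w) where
  vac_mem := Submodule.mem_sInf.2 fun _ hS => hS.1.vac_mem
  mode_mem n a ha b hb := Submodule.mem_sInf.2 fun S hS =>
    hS.1.mode_mem n a (Submodule.mem_sInf.1 ha S hS) b (Submodule.mem_sInf.1 hb S hS)

/-- `½ w_{-1} w`. -/
def confOf (A : PreVOA V) (w : V) : V := (1 / 2 : ℂ) • mode A.Y (-1) w w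

/-- `VA(w)` with the conformal vector `½ w_{-1} w`. -/
def VAVOA (A : PreVOA V) (w : V) : PreVOA (A.VA w) :=
  A.sub (A.VA w) (A.isSubVA_VA w) (A.confOf w)
    (Submodule.smul_mem _ _ ((A.isSubVA_VA w).mode_mem (-1) w (A.mem_VA w) w (A.mem_VA w)))

/-- `Com(S, V) = {v | α_n v = 0 for all α ∈ S and n ≥ 0}`. -/
def commutant (A : PreVOA V) (S : Submodule ℂ V) : Submodule ℂ V where
  carrier := {v | ∀ α ∈ S, ∀ n : ℤ, 0 ≤ n → mode A.Y n α v = 0}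
  add_mem' ha hb α hα n hn := by rw [map_add, ha α hα n hn, hb α hα n hn, add_zero]
  zero_mem' α _ n _ := map_zero _
  smul_mem' c a ha α hα n hn := by rw [map_smul, ha α hα n hn, smul_zero]

theorem commutator_formula (A : PreVOA V) (hA : A.IsVertexAlgebra) (a b x : V) (m n : ℤ) :
    mode A.Y m a (mode A.Y n b x) - mode A.Y n b (mode A.Y m a x) =
      ∑ᶠ i : ℕ, Ring.choose m i • mode A.Y (m + n - i) (mode A.Y i a b) x := by
  have h := hA.borcherds a b x 0 m n
  rw [finsum_eq_single (fun i : ℕ => ((-1) ^ i * Ring.choose (0 : ℤ) i) • _) 0] at h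
  · simpa using h.symm
  · intro i hi
    rw [Ring.choose_zero_pos ℤ (Nat.pos_of_ne_zero hi)]
    simp

theorem isSubVA_commutant (A : PreVOA V) (hA : A.IsVertexAlgebra) (S : Submodule ℂ V) :
    A.IsSubVA (A.commutant S) where
  vac_mem α _ n hn := hA.creation_nonneg α n hn
  mode_mem m a ha b hb α hα n hn := by
    have h := A.commutator_formula hA α a b n m
    rw [hb α hα n hn, map_zero, sub_zero] at h
    rw [h]
    refine finsum_eq_zero_of_forall_eq_zero fun i => ?_
    rw [ha α hα i (by positivity)]
    simp

/-- `Com(S, V)` with the conformal vector `ω'`. -/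
def comVOA (A : PreVOA V) (hA : A.IsVertexAlgebra) (S : Submodule ℂ V) (ω' : V)
    (hω : ω' ∈ A.commutant S) : PreVOA (A.commutant S) :=
  A.sub (A.commutant S) (A.isSubVA_commutant hA S) ω' hω

/-! ### Tensor products -/

section Tensor

variable {W : Type*} [AddCommGroup W] [Module ℂ W]

theorem tensor_truncation (A : PreVOA V) (B : PreVOA W) (x y : V ⊗[ℂ] W) :
    ∃ N : ℤ, ∀ i j : ℤ, N ≤ i ∨ N ≤ j →
      TensorProduct.map₂ (mode A.Y i) (mode B.Y j) x y = 0 := by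
  induction x with
  | zero => exact ⟨0, fun i j _ => by simp⟩
  | add x x' hx hx' =>
    obtain ⟨N, hN⟩ := hx
    obtain ⟨N', hN'⟩ := hx'
    refine ⟨max N N', fun i j h => ?_⟩
    rw [map_add, LinearMap.add_apply, hN i j (by omega), hN' i j (by omega), add_zero]
  | tmul a b =>
    induction y with
    | zero => exact ⟨0, fun i j _ => by simp⟩
    | add y y' hy hy' =>
      obtain ⟨N, hN⟩ := hy
      obtain ⟨N', hN'⟩ := hy'
      refine ⟨max N N', fun i j h => ?_⟩
      rw [map_add, hN i j (by omega), hN' i j (by omega), add_zero]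
    | tmul c d =>
      obtain ⟨N, hN⟩ := mode_truncation A.Y a c
      obtain ⟨N', hN'⟩ := mode_truncation B.Y b d
      refine ⟨max N N', fun i j h => ?_⟩
      rw [TensorProduct.map₂_apply_tmul, TensorProduct.map_tmul]
      rcases h with h | h
      · rw [hN i (by omega), TensorProduct.zero_tmul]
      · rw [hN' j (by omega), TensorProduct.tmul_zero]

theorem tensor_finite (A : PreVOA V) (B : PreVOA W) (n : ℤ) (x y : V ⊗[ℂ] W) :
    (Function.support fun i : ℤ =>
      TensorProduct.map₂ (mode A.Y i) (mode B.Y (n - 1 - i)) x y).Finite := by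
  obtain ⟨N, hN⟩ := tensor_truncation A B x y
  refine (Set.finite_Icc (n - 1 - N) N).subset fun i hi => ?_
  by_contra hcon
  refine hi (hN i _ ?_)
  rw [Set.mem_Icc] at hcon
  omega

/-- The tensor product of vertex operator algebras: `Y(a ⊗ b, z) = Y(a, z) ⊗ Y(b, z)`, that is
`(a ⊗ b)_n (c ⊗ d) = ∑_{i + j = n - 1} a_i c ⊗ b_j d`, with vacuum `𝟏 ⊗ 𝟏` and conformal vector
`ω ⊗ 𝟏 + 𝟏 ⊗ ω`. -/
def tensor (A : PreVOA V) (B : PreVOA W) : PreVOA (V ⊗[ℂ] W) where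
  Y := ofModes
    (fun n => sumBilin
      (fun i : ℤ => TensorProduct.map₂ (mode A.Y i) (mode B.Y (n - 1 - i))) (tensor_finite A B n))
    (fun x y => by
      obtain ⟨N, hN⟩ := tensor_truncation A B x y
      refine ⟨2 * N + 1, fun n hn => finsum_eq_zero_of_forall_eq_zero fun i => hN i _ ?_⟩
      omega)
  vac := A.vac ⊗ₜ B.vac
  conf := A.conf ⊗ₜ B.vac + A.vac ⊗ₜ B.conf

theorem mode_tensor_tmul (A : PreVOA V) (B : PreVOA W) (n : ℤ) (a c : V) (b d : W) :
    mode (tensor A B).Y n (a ⊗ₜ b) (c ⊗ₜ d) =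
      ∑ᶠ i : ℤ, mode A.Y i a c ⊗ₜ[ℂ] mode B.Y (n - 1 - i) b d := by
  simp [tensor, mode_ofModes, sumBilin, sumLin]

end Tensor

end PreVOA

/-! ### The rank-one Heisenberg vertex operator algebra -/

section Heisenberg

variable {M : Type*} [AddCommGroup M] [Module ℂ M]

theorem residueProduct_finite (A B : VertexOperator ℂ M) (l n : ℤ) (x : M) :
    (Function.support fun i : ℕ => (((-1) ^ i * Ring.choose l i : ℤ) •
      (VertexOperator.ncoeff A (l - i) * VertexOperator.ncoeff B (n + i) -
        ((Int.negOnePow l : ℤˣ) : ℤ) •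
          (VertexOperator.ncoeff B (n + l - i) * VertexOperator.ncoeff A i)) :
            Module.End ℂ M) x).Finite := by
  obtain ⟨N, hN⟩ := field_truncation A x
  obtain ⟨N', hN'⟩ := field_truncation B x
  refine (Set.finite_Iio (max N (N' - n)).toNat).subset fun i hi => ?_
  by_contra hcon
  rw [Set.mem_Iio] at hcon
  refine hi ?_
  simp only [LinearMap.smul_apply, LinearMap.sub_apply, Module.End.mul_apply]
  rw [hN i (by omega), hN' (n + i) (by omega)]
  simp

theorem residueProduct_truncation (A B : VertexOperator ℂ M) (l : ℤ) (x : M) :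
    ∃ N : ℤ, ∀ n, N ≤ n → ∑ᶠ i : ℕ, (((-1) ^ i * Ring.choose l i : ℤ) •
      (VertexOperator.ncoeff A (l - i) * VertexOperator.ncoeff B (n + i) -
        ((Int.negOnePow l : ℤˣ) : ℤ) •
          (VertexOperator.ncoeff B (n + l - i) * VertexOperator.ncoeff A i)) :
            Module.End ℂ M) x = 0 := by
  obtain ⟨N, hN⟩ := field_truncation A x
  obtain ⟨N', hN'⟩ := field_truncation B x
  choose K hK using fun i : ℕ => field_truncation B (VertexOperator.ncoeff A (i : ℤ) x)
  have hb : ∃ C : ℤ, ∀ i ∈ Finset.range N.toNat, K i + i - l ≤ C := by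
    obtain ⟨C, hC⟩ := (Finset.image (fun i : ℕ => K i + i - l) (Finset.range N.toNat)).bddAbove
    exact ⟨C, fun i hi => hC (by simpa using ⟨i, by simpa using hi, rfl⟩)⟩
  obtain ⟨C, hC⟩ := hb
  refine ⟨max N' C, fun n hn => finsum_eq_zero_of_forall_eq_zero fun i => ?_⟩
  have h2 : VertexOperator.ncoeff B (n + l - i) (VertexOperator.ncoeff A (i : ℤ) x) = 0 := by
    by_cases hi : i < N.toNat
    · have := hC i (Finset.mem_range.2 hi)
      exact hK i _ (by omega)
    · rw [hN i (by omega), map_zero]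
  simp only [LinearMap.smul_apply, LinearMap.sub_apply, Module.End.mul_apply]
  rw [h2, hN' (n + i) (by omega)]
  simp

/-- The `l`-th product of two fields on `M`; its `n`-th mode is
`∑_i (-1)^i C(l,i) (A_{l-i} B_{n+i} - (-1)^l B_{n+l-i} A_i)`.  For `l = -k-1` it is the normally
ordered product of `∂^k A / k!` and `B`. -/
def residueProduct (A B : VertexOperator ℂ M) (l : ℤ) : VertexOperator ℂ M :=
  fieldOfModes (fun n => sumLin _ (residueProduct_finite A B l n))
    (residueProduct_truncation A B l)

/-- The identity field. -/
def idField (M : Type*) [AddCommGroup M] [Module ℂ M] : VertexOperator ℂ M :=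
  fieldOfModes (fun n => if n = -1 then 1 else 0)
    (fun _ => ⟨0, fun n hn => by rw [if_neg (by omega)]; rfl⟩)

/-- The Fock space `ℂ[x_1, x_2, …]`; the variable `x_{k+1}` is `MvPolynomial.X k`. -/
abbrev Fock : Type := MvPolynomial ℕ ℂ

/-- The Heisenberg operators on the Fock space: `a(-n) = x_n` and `a(n) = n ∂/∂x_n` for `n ≥ 1`,
and `a(0) = 0`. -/
def heisenbergMode (n : ℤ) : Module.End ℂ Fock :=
  if n < 0 then LinearMap.mulLeft ℂ (MvPolynomial.X (-n - 1).toNat)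
  else (n : ℂ) • (MvPolynomial.pderiv (R := ℂ) (n - 1).toNat).toLinearMap

theorem heisenbergMode_truncation (p : Fock) :
    ∃ N : ℤ, ∀ n, N ≤ n → heisenbergMode n p = 0 := by
  refine ⟨(p.vars.sup id : ℕ) + 2, fun n hn => ?_⟩
  rw [heisenbergMode, if_neg (by omega)]
  have : MvPolynomial.pderiv (n - 1).toNat p = 0 := by
    refine MvPolynomial.pderiv_eq_zero_of_notMem_vars fun hmem => ?_
    have := Finset.le_sup (f := id) hmem
    simp only [id] at this
    omega
  rw [LinearMap.smul_apply]
  exact (congrArg _ this).trans (smul_zero _)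

/-- The free boson field `a(z) = ∑ a(n) z^{-n-1}`. -/
def heisenbergField : VertexOperator ℂ Fock :=
  fieldOfModes heisenbergMode heisenbergMode_truncation

/-- The rank-one Heisenberg vertex operator algebra `M(1)`.  The field of the state
`a(-k_1-1) ⋯ a(-k_r-1) 𝟏`, `k_1 ≤ ⋯ ≤ k_r`, is the iterated normally ordered product of the
`∂^{k_i} a(z) / k_i!`; the conformal vector is `½ a(-1)² 𝟏`. -/
def heisenberg : PreVOA Fock where
  Y := (MvPolynomial.basisMonomials ℕ ℂ).constr ℂ fun s =>
    ((Finsupp.toMultiset s).sort (· ≤ ·)).foldr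
      (fun (k : ℕ) B => residueProduct heisenbergField B (-(k : ℤ) - 1)) (idField Fock)
  vac := 1
  conf := MvPolynomial.C (1 / 2) * MvPolynomial.X 0 ^ 2

end Heisenberg

/-! ### The central element attached to a self-extension -/

namespace PreVOA

variable {V M : Type*} [AddCommGroup V] [Module ℂ V] [AddCommGroup M] [Module ℂ M]

/-- `t` is an inverse image of `𝟏` under `ψ : M → V` in the generalized eigenspace of `L(0)` with
eigenvalue `0`. -/
def IsVacuumLift (A : PreVOA V) (Y : V →ₗ[ℂ] VertexOperator ℂ M) (ψ : M →ₗ[ℂ] V) (t : M) : Prop :=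
  t ∈ Module.End.maxGenEigenspace (A.virasoroOn Y 0) 0 ∧ ψ t = A.vac

/-- `w` lies in `ℂ(u + φ(u))` or in `ℂ(u - φ(u))`, and `w_1 w = 𝟏`. -/
def IsNormalized (A : PreVOA V) (U : A.UnitaryStructure) (u w : V) : Prop :=
  (w ∈ Submodule.span ℂ {u + U.φ u} ∨ w ∈ Submodule.span ℂ {u - U.φ u}) ∧
    mode A.Y 1 w w = A.vac

end PreVOA

end VOA

end

noncomputable section

namespace VOA

/-! ### Calculus of modes -/

namespace PreVOA

/-! Let `t` be a lift of the vacuum. As L(-1)𝟏 = 0, L(-1)t = ι(u) for some u. Here u ≠ 0: otherwise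
every a_n t with n ≥ 0 vanishes and a ↦ a_{-1}t splits the extension. The bracket [L(0), L(-1)] =
L(-1) puts u in weight 1. Moreover a_n u = L(-1)s_n + n s_{n-1} with ι(s_n) = a_n t, and skew
symmetry turns u_0 a into a telescoping sum, so u_0 = 0 on V
(`IsNonsplitExtension.zero_mode_eq_zero`).

Unitarity gives L(1)V_1 = 0, so for a in V_1 the modes a_{-m} and -φ(a)_m are adjoint. Of u ± φ(u)
at least one is nonzero; φ fixes or negates it, so positivity makes its first mode on itself a
nonzero multiple of 𝟏, and it can be rescaled to w. The modes of w satisfy the Heisenberg relations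
with w_0 = 0, and w_k is adjoint to a multiple of w_{-k}; `IsBoson` records exactly this.

The creation operators of w make V a module over the polynomial ring `Fock`. On a vector killed by
all w_n with n ≥ 0, this action intertwines the Heisenberg operators (`IsBoson.mode_fockAct`), and
the associativity formula propagates this to all fields (`IsBoson.mode_fockAct_fockAct`), which
identifies VA(w) with M(1). The vectors killed by these w_n form the commutant of VA(w).
Multiplication from `Fock` tensor commutant to V is injective because annihilation operators
differentiate polynomials, and surjective by complete reducibility: a vector orthogonal to a stable
subspace in its weight is a vacuum vector (`IsBoson.eq_top_of_stable`). Associativity and the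
commutation of the two factors make it an isomorphism of VOAs.

For the failure of holomorphy, Li's operator Δ(z) built from w deforms the adjoint module to
Y(Δ(z)a, z) (`IsBoson.deform_mode`, `IsBoson.borcherds_deformedY`). The deformed module keeps the
grading and, when V is simple, is simple; but w_0 acts on it as the identity, whereas w_0 = 0 on V.
-/

theorem IsVertexAlgebra.isModule {V : Type*} [AddCommGroup V] [Module ℂ V] {A : PreVOA V}
    (hA : A.IsVertexAlgebra) : A.IsModule A.Y :=
  ⟨hA.vacuum, hA.borcherds⟩

section Calculus

variable {V M : Type*} [AddCommGroup V] [Module ℂ V] [AddCommGroup M] [Module ℂ M]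
  {A : PreVOA V} {Y : V →ₗ[ℂ] VertexOperator ℂ M}

theorem IsModule.commutator (hY : A.IsModule Y) (a b : V) (x : M) (m n : ℤ) :
    mode Y m a (mode Y n b x) - mode Y n b (mode Y m a x) =
      ∑ᶠ i : ℕ, Ring.choose m i • mode Y (m + n - i) (mode A.Y i a b) x := by
  have h := hY.borcherds a b x 0 m n
  rw [finsum_eq_single (fun i : ℕ => ((-1) ^ i * Ring.choose (0 : ℤ) i) • _) 0] at h
  · simpa using h.symm
  · intro i hi
    rw [Ring.choose_zero_pos ℤ (Nat.pos_of_ne_zero hi)]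
    simp

theorem IsModule.commutator_eq_sum (hY : A.IsModule Y) (a b : V) (x : M) (m n : ℤ) (N : ℕ)
    (hN : ∀ i : ℕ, N ≤ i → Ring.choose m i • mode A.Y i a b = 0) :
    mode Y m a (mode Y n b x) - mode Y n b (mode Y m a x) =
      ∑ i ∈ Finset.range N, Ring.choose m i • mode Y (m + n - i) (mode A.Y i a b) x := by
  rw [hY.commutator, finsum_eq_sum_of_support_subset]
  intro i hi
  by_contra hcon
  refine hi ?_
  have := hN i (by simpa using hcon)
  have h2 : mode Y (m + n - i) (Ring.choose m i • mode A.Y i a b) x = 0 := by rw [this]; simp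
  simpa using h2

theorem IsModule.commutator_nat (hY : A.IsModule Y) (a b : V) (x : M) (m : ℕ) (n : ℤ) :
    mode Y m a (mode Y n b x) - mode Y n b (mode Y m a x) =
      ∑ i ∈ Finset.range (m + 1), m.choose i • mode Y (m + n - i) (mode A.Y i a b) x := by
  rw [hY.commutator_eq_sum a b x m n (m + 1)]
  · refine Finset.sum_congr rfl fun i _ => ?_
    rw [Ring.choose_natCast]
    simp
  · intro i hi
    rw [Ring.choose_natCast, Nat.choose_eq_zero_of_lt hi]
    simp

theorem IsModule.associator (hY : A.IsModule Y) (a b : V) (x : M) (l n : ℤ) :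
    mode Y n (mode A.Y l a b) x =
      ∑ᶠ i : ℕ, ((-1) ^ i * Ring.choose l i) •
        (mode Y (l - i) a (mode Y (n + i) b x) -
          ((Int.negOnePow l : ℤˣ) : ℤ) • mode Y (n + l - i) b (mode Y i a x)) := by
  have h := hY.borcherds a b x l 0 n
  rw [finsum_eq_single (fun i : ℕ => Ring.choose (0 : ℤ) i • _) 0] at h
  · simpa using h
  · intro i hi
    rw [Ring.choose_zero_pos ℤ (Nat.pos_of_ne_zero hi)]
    simp

theorem choose_neg_one (i : ℕ) : Ring.choose (-1 : ℤ) i = (-1) ^ i := by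
  rw [Ring.choose_neg', Ring.multichoose_eq]
  have : (1 : ℤ) + i - 1 = (i : ℕ) := by ring
  rw [this, Ring.choose_natCast, Nat.choose_self, Units.smul_def, Int.coe_negOnePow_natCast]
  simp

theorem choose_neg_two (i : ℕ) : Ring.choose (-2 : ℤ) i = (-1) ^ i * (i + 1) := by
  rw [Ring.choose_neg', Ring.multichoose_eq]
  have : (2 : ℤ) + i - 1 = ((i + 1 : ℕ) : ℤ) := by push_cast; ring
  rw [this, Ring.choose_natCast, Nat.choose_succ_self_right, Units.smul_def,
    Int.coe_negOnePow_natCast]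
  push_cast
  simp

/-- The Borcherds identity on the vacuum with m = -1, n = 0: the creation axiom leaves one term on
the right. Modes on 𝟏 stand in for the usual exponential of L(-1). -/
theorem IsVertexAlgebra.skew (hA : A.IsVertexAlgebra) (a b : V) (l : ℤ) :
    mode A.Y l b a = -(((Int.negOnePow l : ℤˣ) : ℤ) •
      ∑ᶠ i : ℕ, ((-1) ^ i : ℤ) • mode A.Y (-1 - i) (mode A.Y (l + i) a b) A.vac) := by
  have h := hA.borcherds a b A.vac l (-1) 0
  rw [finsum_eq_single (fun i : ℕ => ((-1) ^ i * Ring.choose l i) • _) 0] at h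
  · simp only [choose_neg_one] at h
    rw [show (-1 : ℤ) + 0 = -1 from rfl] at h
    rw [h]
    have h1 : mode A.Y (0 + ((0 : ℕ) : ℤ)) b A.vac = 0 := hA.creation_nonneg b _ (by simp)
    have h2 : mode A.Y (-1 + ((0 : ℕ) : ℤ)) a A.vac = a := by simpa using hA.creation a
    rw [h1, h2]
    simp only [pow_zero, Ring.choose_zero_right, map_zero, zero_sub, one_mul, smul_neg,
      smul_smul, neg_neg, Nat.cast_zero, zero_add, sub_zero]
    rw [← Units.val_mul, ← Int.negOnePow_add, Int.negOnePow_even _ ⟨l, rfl⟩]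
    simp
  · intro i hi
    rw [hA.creation_nonneg b _ (by positivity), hA.creation_nonneg a (-1 + i) (by omega)]
    simp

theorem IsVertexAlgebra.mode_eq_zero_symm (hA : A.IsVertexAlgebra) {a b : V}
    (h : ∀ n : ℤ, 0 ≤ n → mode A.Y n a b = 0) (n : ℤ) (hn : 0 ≤ n) : mode A.Y n b a = 0 := by
  rw [hA.skew a b n, finsum_eq_zero_of_forall_eq_zero, smul_zero, neg_zero]
  intro i
  rw [h (n + i) (by positivity)]
  simp

/-- In the associativity formula the vacuum has only its mode -1, so at most one term survives: from
the first family if n < 0, from the second if n > 0. This carries the derivative property, an axiom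
on V only, over to every module. -/
theorem IsModule.mode_mode_neg_two_vac (hY : A.IsModule Y) (a : V) (x : M) (n : ℤ) :
    mode Y n (mode A.Y (-2) a A.vac) x = -(n : ℂ) • mode Y (n - 1) a x := by
  rw [hY.associator]
  have hv : ∀ (n : ℤ) (x : M), mode Y n A.vac x = if n = -1 then x else 0 := hY.vacuum
  have e : ∀ i : ℕ, ((-1) ^ i * Ring.choose (-2 : ℤ) i) = i + 1 := by
    intro i
    rw [choose_neg_two, ← mul_assoc, ← mul_pow]
    simp
  simp only [e, hv, Int.negOnePow_even (-2) ⟨-1, rfl⟩, Units.val_one, one_smul]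
  rcases lt_trichotomy n 0 with hn | hn | hn
  · obtain ⟨k, rfl⟩ : ∃ k : ℕ, n = -1 - k := ⟨(-1 - n).toNat, by omega⟩
    rw [finsum_eq_single _ k]
    · rw [if_pos (by ring), if_neg (by omega), sub_zero,
        show (-1 - (k : ℤ) - 1) = -2 - k by ring, ← Int.cast_smul_eq_zsmul ℂ]
      congr 1
      push_cast
      ring
    · intro i hi
      rw [if_neg (by omega), if_neg (by omega)]
      simp
  · subst hn
    rw [finsum_eq_zero_of_forall_eq_zero]
    · simp
    · intro i
      rw [if_neg (by omega), if_neg (by omega)]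
      simp
  · obtain ⟨k, rfl⟩ : ∃ k : ℕ, n = k + 1 := ⟨(n - 1).toNat, by omega⟩
    rw [finsum_eq_single _ k]
    · rw [if_neg (by omega), if_pos (by ring), map_zero, zero_sub,
        show ((k : ℤ) + 1 - 1) = k by ring, ← Int.cast_smul_eq_zsmul ℂ, smul_neg, ← neg_smul]
    · intro i hi
      rw [if_neg (by omega), if_neg (by omega)]
      simp

theorem IsVOA.L_neg_one_eq (hA : A.IsVOA) (a : V) : A.L (-1) a = mode A.Y (-2) a A.vac := by
  have := congrArg (fun f => f A.vac) (hA.derivative a (-1))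
  simp only [hA.creation] at this
  rw [this]
  simp

theorem IsVOA.derivative_on (hA : A.IsVOA) (hY : A.IsModule Y) (a : V) (n : ℤ) (x : M) :
    mode Y n (A.L (-1) a) x = -(n : ℂ) • mode Y (n - 1) a x := by
  rw [hA.L_neg_one_eq, hY.mode_mode_neg_two_vac]

theorem L_apply (n : ℤ) (a : V) : A.L n a = mode A.Y (n + 1) A.conf a := rfl

theorem virasoroOn_apply (n : ℤ) (x : M) : A.virasoroOn Y n x = mode Y (n + 1) A.conf x := rfl

theorem IsVOA.L_neg_one_comm (hA : A.IsVOA) (hY : A.IsModule Y) (a : V) (n : ℤ) (x : M) :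
    A.virasoroOn Y (-1) (mode Y n a x) =
      mode Y n a (A.virasoroOn Y (-1) x) - (n : ℂ) • mode Y (n - 1) a x := by
  have h := hY.commutator_nat A.conf a x 0 n
  simp only [zero_add, Finset.range_one, Finset.sum_singleton, Nat.choose_self, one_smul,
    Nat.cast_zero, sub_zero] at h
  have h2 := hA.derivative_on hY a n x
  rw [L_apply, show (-1 : ℤ) + 1 = 0 from rfl] at h2
  rw [virasoroOn_apply, virasoroOn_apply, show (-1 : ℤ) + 1 = 0 from rfl,
    sub_eq_iff_eq_add'.1 h, h2]
  module

theorem IsVOA.L_zero_comm (hA : A.IsVOA) (hY : A.IsModule Y) {a : V} {k : ℤ}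
    (ha : a ∈ A.weight k) (n : ℤ) (x : M) :
    A.virasoroOn Y 0 (mode Y n a x) =
      mode Y n a (A.virasoroOn Y 0 x) + ((k : ℂ) - n - 1) • mode Y n a x := by
  have h := hY.commutator_nat A.conf a x 1 n
  rw [Finset.sum_range_succ, Finset.sum_range_one] at h
  have h2 := hA.derivative_on hY a (n + 1) x
  rw [L_apply, show (-1 : ℤ) + 1 = 0 from rfl] at h2
  have h3 : mode A.Y 1 A.conf a = (k : ℂ) • a := Module.End.mem_eigenspace_iff.1 ha
  simp only [Nat.cast_one, Nat.cast_zero, Nat.choose_self, Nat.choose_zero_right, one_smul,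
    sub_zero, h3] at h
  rw [show (1 : ℤ) + n = n + 1 by ring, h2] at h
  simp only [add_sub_cancel_right, map_smul, LinearMap.smul_apply] at h
  rw [virasoroOn_apply, virasoroOn_apply, show (0 : ℤ) + 1 = 1 from rfl,
    sub_eq_iff_eq_add'.1 h]
  push_cast
  module

theorem mem_weight_iff {a : V} {n : ℤ} : a ∈ A.weight n ↔ A.L 0 a = (n : ℂ) • a :=
  Module.End.mem_eigenspace_iff

theorem IsVOA.mode_mem_weight (hA : A.IsVOA) {a b : V} {k j : ℤ}
    (ha : a ∈ A.weight k) (hb : b ∈ A.weight j) (n : ℤ) :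
    mode A.Y n a b ∈ A.weight (k + j - n - 1) := by
  rw [mem_weight_iff] at hb ⊢
  have := hA.L_zero_comm hA.isModule ha n b
  change A.L 0 _ = mode A.Y n a (A.L 0 b) + _ at this
  rw [this, hb]
  push_cast
  rw [map_smul]
  module

theorem IsVOA.vac_mem_weight (hA : A.IsVOA) : A.vac ∈ A.weight 0 := by
  rw [mem_weight_iff, L_apply, hA.creation_nonneg _ _ (by norm_num)]
  simp

/-- ω = L(-2)𝟏, so this is [L(0), L(-2)] = 2L(-2) applied to the vacuum. -/
theorem IsVOA.conf_mem_weight (hA : A.IsVOA) : A.conf ∈ A.weight 2 := by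
  obtain ⟨c, hc⟩ := hA.virasoro
  have h := congrArg (fun f => f A.vac) (hc 0 (-2))
  have h0 : A.L 0 A.vac = 0 := hA.creation_nonneg _ _ (by norm_num)
  have h2 : A.L (-2) A.vac = A.conf := hA.creation _
  simp only [LinearMap.sub_apply, Module.End.mul_apply, h0, h2, map_zero, sub_zero,
    LinearMap.add_apply, LinearMap.smul_apply] at h
  rw [mem_weight_iff, h]
  norm_num [h2]

theorem IsVOA.L_one_conf (hA : A.IsVOA) : A.L 1 A.conf = 0 := by
  obtain ⟨c, hc⟩ := hA.virasoro
  have h := congrArg (fun f => f A.vac) (hc 1 (-2))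
  have h0 : A.L 1 A.vac = 0 := hA.creation_nonneg _ _ (by norm_num)
  have h1 : A.L (-1) A.vac = 0 := hA.creation_nonneg _ _ (by norm_num)
  have h2 : A.L (-2) A.vac = A.conf := hA.creation _
  simp only [LinearMap.sub_apply, Module.End.mul_apply, h0, h2, map_zero, sub_zero,
    LinearMap.add_apply, LinearMap.smul_apply] at h
  rw [h]
  norm_num [h1]

theorem IsVOA.L_neg_one_vac (hA : A.IsVOA) : A.L (-1) A.vac = 0 :=
  hA.creation_nonneg _ _ (by norm_num)

theorem IsVOA.span_weight (hA : A.IsVOA) : ⨆ n, A.weight n = ⊤ :=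
  hA.grading.submodule_iSup_eq_top

/-- To prove an additive property of vectors, prove it for homogeneous ones. -/
theorem IsVOA.weight_induction (hA : A.IsVOA) {P : V → Prop}
    (hom : ∀ n, ∀ a ∈ A.weight n, P a) (add : ∀ a b, P a → P b → P (a + b)) (a : V) : P a := by
  have ha : a ∈ ⨆ n, A.weight n := by rw [hA.span_weight]; trivial
  exact Submodule.iSup_induction A.weight (motive := P) ha hom (hom 0 0 (zero_mem _)) add

end Calculus

/-! ### Gradings -/

section Grading

variable {V : Type*} [AddCommGroup V] [Module ℂ V] {A : PreVOA V}

theorem IsVOA.exists_sum_weight (hA : A.IsVOA) (a : V) :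
    ∃ (s : Finset ℤ) (f : ℤ → V), (∀ n, f n ∈ A.weight n) ∧ a = ∑ n ∈ s, f n := by
  have ha : a ∈ ⨆ n, A.weight n := by rw [hA.span_weight]; trivial
  obtain ⟨f, hf, rfl⟩ := (Submodule.mem_iSup_iff_exists_finsupp _ _).1 ha
  exact ⟨f.support, f, hf, rfl⟩

/-- Applying L(0) - k removes the component of weight k and rescales the others by nonzero numbers;
induct on the number of components. -/
theorem mem_of_sum_weight_mem {S : Submodule ℂ V} (hS : ∀ x ∈ S, A.L 0 x ∈ S) (s : Finset ℤ)
    (f : ℤ → V) (hf : ∀ n ∈ s, f n ∈ A.weight n) (h : ∑ n ∈ s, f n ∈ S) : ∀ n ∈ s, f n ∈ S := by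
  induction s using Finset.induction_on generalizing f with
  | empty => simp
  | insert k s hk ih =>
    have key : ∀ n ∈ s, f n ∈ S := by
      have h2 : ∑ n ∈ s, ((n : ℂ) - k) • f n ∈ S := by
        have h3 := S.sub_mem (hS _ h) (S.smul_mem (k : ℂ) h)
        rw [map_sum, Finset.smul_sum, ← Finset.sum_sub_distrib, Finset.sum_insert hk] at h3
        rw [mem_weight_iff.1 (hf k (Finset.mem_insert_self _ _)), sub_self, zero_add] at h3
        convert h3 using 2 with n hn
        rw [mem_weight_iff.1 (hf n (Finset.mem_insert_of_mem hn))]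
        module
      intro n hn
      have h4 := ih (fun n => ((n : ℂ) - k) • f n)
        (fun n hn => Submodule.smul_mem _ _ (hf n (Finset.mem_insert_of_mem hn))) h2 n hn
      have hne : (n : ℂ) - k ≠ 0 := by
        rw [sub_ne_zero]
        exact_mod_cast fun e : n = k => hk (e ▸ hn)
      exact (S.smul_mem_iff hne).1 h4
    intro n hn
    rcases Finset.mem_insert.1 hn with rfl | hn
    · rw [Finset.sum_insert hk] at h
      exact (S.add_mem_iff_left (S.sum_mem key)).1 h
    · exact key n hn

theorem IsVOA.exists_sum_weight_of_mem (hA : A.IsVOA) {S : Submodule ℂ V}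
    (hS : ∀ x ∈ S, A.L 0 x ∈ S) {a : V} (ha : a ∈ S) :
    ∃ (s : Finset ℤ) (f : ℤ → V), (∀ n, f n ∈ A.weight n) ∧ (∀ n ∈ s, f n ∈ S) ∧
      a = ∑ n ∈ s, f n := by
  obtain ⟨s, f, hf, rfl⟩ := hA.exists_sum_weight a
  exact ⟨s, f, hf, mem_of_sum_weight_mem hS s f (fun n _ => hf n) ha, rfl⟩

/-- L(0) is diagonalizable on V, so its generalized kernel is its kernel. -/
theorem IsVOA.mem_weight_zero_of_pow (hA : A.IsVOA) {a : V} {k : ℕ}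
    (ha : ((A.L 0) ^ k) a = 0) : a ∈ A.weight 0 := by
  obtain ⟨s, f, hf, hS, rfl⟩ := hA.exists_sum_weight_of_mem
    (S := LinearMap.ker ((A.L 0) ^ k)) (fun x hx => by
      rw [LinearMap.mem_ker] at hx ⊢
      rw [← Module.End.mul_apply, ← pow_succ, pow_succ', Module.End.mul_apply, hx, map_zero]) ha
  refine Submodule.sum_mem _ fun n hn => ?_
  by_cases h0 : n = 0
  · exact h0 ▸ hf n
  · have h1 : ∀ j : ℕ, ((A.L 0) ^ j) (f n) = (n : ℂ) ^ j • f n := by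
      intro j
      induction j with
      | zero => simp
      | succ j ih =>
        rw [pow_succ', Module.End.mul_apply, ih, map_smul, mem_weight_iff.1 (hf n), smul_smul,
          pow_succ]
    have h2 := hS n hn
    rw [LinearMap.mem_ker, h1, smul_eq_zero] at h2
    have : f n = 0 := h2.resolve_left (pow_ne_zero _ (by exact_mod_cast h0))
    rw [this]
    exact zero_mem _

theorem IsVOA.exists_L_zero_add (hA : A.IsVOA) (a : V) :
    ∃ b, ∃ c ∈ A.weight 0, A.L 0 b + c = a := by
  refine hA.weight_induction (P := fun a => ∃ b, ∃ c ∈ A.weight 0, A.L 0 b + c = a) ?_ ?_ a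
  · intro n a ha
    by_cases h0 : n = 0
    · exact ⟨0, a, h0 ▸ ha, by simp⟩
    · refine ⟨(n : ℂ)⁻¹ • a, 0, zero_mem _, ?_⟩
      rw [map_smul, mem_weight_iff.1 ha, smul_smul, inv_mul_cancel₀ (by exact_mod_cast h0)]
      simp
  · rintro _ _ ⟨b, c, hc, rfl⟩ ⟨b', c', hc', rfl⟩
    exact ⟨b + b', c + c', add_mem hc hc', by rw [map_add]; abel⟩

end Grading

/-! ### Self-extensions -/

section Extension

variable {V M : Type*} [AddCommGroup V] [Module ℂ V] [AddCommGroup M] [Module ℂ M]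
  {A : PreVOA V} {Y : V →ₗ[ℂ] VertexOperator ℂ M} {ι : V →ₗ[ℂ] M} {ψ : M →ₗ[ℂ] V}

theorem _root_.VOA.IsNonsplitExtension.exists_eq (hext : IsNonsplitExtension A.Y Y A.Y ι ψ)
    {x : M} (hx : ψ x = 0) : ∃ v, ι v = x := by
  have : x ∈ LinearMap.range ι := by rw [hext.exact]; exact hx
  exact this

theorem _root_.VOA.IsNonsplitExtension.apply_ι (hext : IsNonsplitExtension A.Y Y A.Y ι ψ)
    (v : V) : ψ (ι v) = 0 := by
  have : ι v ∈ LinearMap.ker ψ := by rw [← hext.exact]; exact ⟨v, rfl⟩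
  exact this

theorem _root_.VOA.IsNonsplitExtension.exists_isVacuumLift
    (hext : IsNonsplitExtension A.Y Y A.Y ι ψ) (hA : A.IsVOA) : ∃ t, A.IsVacuumLift Y ψ t := by
  obtain ⟨t₀, ht₀⟩ := hext.surjective A.vac
  have h1 : ψ (A.virasoroOn Y 0 t₀) = 0 := by
    rw [virasoroOn_apply, hext.hom_right, ht₀]
    exact hA.creation_nonneg _ _ (by norm_num)
  obtain ⟨v, hv⟩ := hext.exists_eq h1
  obtain ⟨b, c, hc, rfl⟩ := hA.exists_L_zero_add v
  -- After this correction L(0) sends the lift to ι(c) with L(0)c = 0, hence exponent 2 below.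
  refine ⟨t₀ - ι b, ?_, ?_⟩
  · rw [Module.End.mem_maxGenEigenspace]
    refine ⟨2, ?_⟩
    have h2 : A.virasoroOn Y 0 (t₀ - ι b) = ι c := by
      rw [map_sub, ← hv, virasoroOn_apply, ← hext.hom_left, ← L_apply, map_add]
      abel
    rw [zero_smul, sub_zero, pow_two, Module.End.mul_apply, h2, virasoroOn_apply,
      ← hext.hom_left, ← L_apply, mem_weight_iff.1 hc]
    simp
  · rw [map_sub, ht₀, hext.apply_ι, sub_zero]

/-- On a lift of the vacuum, `L(0)` takes a value in the image of the vacuum line. -/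
theorem _root_.VOA.IsNonsplitExtension.L_zero_lift
    (hext : IsNonsplitExtension A.Y Y A.Y ι ψ) (hA : A.IsVOA) {t : M}
    (ht : A.IsVacuumLift Y ψ t) : ∃ c ∈ A.weight 0, ι c = A.virasoroOn Y 0 t := by
  have h1 : ψ (A.virasoroOn Y 0 t) = 0 := by
    rw [virasoroOn_apply, hext.hom_right, ht.2]
    exact hA.creation_nonneg _ _ (by norm_num)
  obtain ⟨v, hv⟩ := hext.exists_eq h1
  obtain ⟨k, hk⟩ := (Module.End.mem_maxGenEigenspace _ _ _).1 ht.1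
  rw [zero_smul, sub_zero] at hk
  refine ⟨v, hA.mem_weight_zero_of_pow (k := k) (hext.injective ?_), hv⟩
  have h2 : ∀ j : ℕ, ι (((A.L 0) ^ j) v) = ((A.virasoroOn Y 0) ^ j) (A.virasoroOn Y 0 t) := by
    intro j
    induction j with
    | zero => simpa using hv
    | succ j ih =>
      rw [pow_succ', Module.End.mul_apply, L_apply, hext.hom_left, ih, pow_succ',
        Module.End.mul_apply]
      rfl
  rw [h2, ← Module.End.mul_apply, ← pow_succ, pow_succ', Module.End.mul_apply, hk, map_zero,
    map_zero]

/-- L(0)L(-1)t = L(-1)t + L(-1)L(0)t. By CFT-type, L(0)t lies in the image of ℂ𝟏, so the last term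
is zero. -/
theorem _root_.VOA.IsNonsplitExtension.exists_weight_one
    (hext : IsNonsplitExtension A.Y Y A.Y ι ψ) (hA : A.IsVOA) (hcft : A.IsCFTType)
    (hY : A.IsModule Y) {t : M} (ht : A.IsVacuumLift Y ψ t) :
    ∃ u ∈ A.weight 1, ι u = A.virasoroOn Y (-1) t := by
  have h1 : ψ (A.virasoroOn Y (-1) t) = 0 := by
    rw [virasoroOn_apply, hext.hom_right, ht.2]
    exact hA.creation_nonneg _ _ (by norm_num)
  obtain ⟨u, hu⟩ := hext.exists_eq h1
  refine ⟨u, ?_, hu⟩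
  obtain ⟨c, hc, hct⟩ := hext.L_zero_lift hA ht
  rw [mem_weight_iff]
  apply hext.injective
  have h2 := hA.L_zero_comm hY hA.conf_mem_weight 0 t
  rw [show mode Y 0 A.conf t = ι u from hu.symm, ← hct, ← hext.hom_left, virasoroOn_apply,
    ← hext.hom_left] at h2
  rw [hcft.weight_zero] at hc
  obtain ⟨z, rfl⟩ := Submodule.mem_span_singleton.1 hc
  rw [map_smul, show mode A.Y 0 A.conf A.vac = 0 from hA.L_neg_one_vac] at h2
  rw [L_apply, h2]
  norm_num

/-- If `L(-1)` kills a lift of the vacuum, the extension splits. -/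
theorem _root_.VOA.IsNonsplitExtension.L_neg_one_lift_ne_zero
    (hext : IsNonsplitExtension A.Y Y A.Y ι ψ) (hA : A.IsVOA)
    (hY : A.IsModule Y) {t : M} (ht : ψ t = A.vac) : A.virasoroOn Y (-1) t ≠ 0 := by
  intro h0
  -- Descend from the truncation bound: a_n t = 0 and L(-1)t = 0 give n a_{n-1}t = 0. Division by n
  -- is allowed down to n = 1, which reaches a_0 t.
  have h1 : ∀ (a : V) (n : ℤ), 0 ≤ n → mode Y n a t = 0 := by
    intro a n hn
    obtain ⟨N, hN⟩ := mode_truncation Y a t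
    by_cases hnN : N ≤ n
    · exact hN n hnN
    · obtain ⟨k, rfl⟩ : ∃ k : ℕ, n = N - k := ⟨(N - n).toNat, by omega⟩
      clear hnN
      induction k with
      | zero => exact hN _ (by simp)
      | succ k ih =>
        have h2 := ih (by push_cast at hn; omega)
        have h3 := hA.L_neg_one_comm hY a (N - k) t
        rw [h2, h0, map_zero, map_zero, zero_sub, eq_comm, neg_eq_zero, smul_eq_zero] at h3
        have h4 : ((N - k : ℤ) : ℂ) ≠ 0 := by
          exact_mod_cast (show (N - k : ℤ) ≠ 0 by push_cast at hn; omega)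
        have h5 := h3.resolve_left h4
        rwa [show (N - k - 1 : ℤ) = N - (k + 1 : ℕ) by push_cast; ring] at h5
  -- Now `t` behaves like a vacuum, and creation from `t` is a section of ψ.
  refine hext.nonsplit ⟨(mode Y (-1)).flip t, ?_, ?_⟩
  · intro a n b
    change mode Y (-1) (mode A.Y n a b) t = mode Y n a (mode Y (-1) b t)
    rw [hY.associator, finsum_eq_single _ 0]
    · rw [h1 a _ (by simp)]
      simp
    · intro i hi
      rw [h1 a i (by positivity), h1 b _ (by omega)]
      simp
  · ext a
    change ψ (mode Y (-1) a t) = a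
    rw [hext.hom_right, ht, hA.creation]

/-- The zero mode of the vector attached to a self-extension vanishes. -/
theorem _root_.VOA.IsNonsplitExtension.zero_mode_eq_zero
    (hext : IsNonsplitExtension A.Y Y A.Y ι ψ) (hA : A.IsVOA) (hY : A.IsModule Y) {t : M}
    (ht : ψ t = A.vac) {u : V} (hu : ι u = A.virasoroOn Y (-1) t) (a : V) :
    mode A.Y 0 u a = 0 := by
  have h1 : ∀ n : ℕ, ∃ v, ι v = mode Y n a t := fun n => hext.exists_eq <| by
    rw [hext.hom_right, ht]
    exact hA.creation_nonneg _ _ (by positivity)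
  choose s hs using h1
  -- Pull back a_n L(-1)t = L(-1)a_n t + n a_{n-1}t. For n = 0 the truncated index n - 1 is
  -- harmless, its coefficient being 0.
  have h2 : ∀ n : ℕ, mode A.Y n a u = A.L (-1) (s n) + (n : ℂ) • s (n - 1) := by
    intro n
    apply hext.injective
    have h3 := hA.L_neg_one_comm hY a n t
    rw [hext.hom_left, hu, map_add, map_smul, L_apply, hext.hom_left, hs,
      ← virasoroOn_apply, h3]
    rcases n with _ | n
    · simp
    · rw [hs]
      push_cast
      simp
  obtain ⟨N, hN⟩ := mode_truncation Y a t
  have hN' : ∀ n : ℕ, N.toNat ≤ n → s n = 0 := fun n hn => hext.injective <| by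
    rw [hs, hN _ (by omega), map_zero]
  -- The telescoping potential: in the i-th term of skew symmetry, L(-1)s_i contributes (i+1) times
  -- the mode -2-i of s_i, which is -g(i+1) up to the common sign convention. Both ends vanish: g(0)
  -- by its factor i, the far end by truncation.
  set g : ℕ → V := fun i =>
    ((-1 : ℂ) ^ i * i) • mode A.Y (-1 - i) (s (i - 1)) A.vac with hg
  have h3 : ∀ i : ℕ, ((-1) ^ i : ℤ) • mode A.Y (-1 - i) (mode A.Y (0 + i) a u) A.vac =
      g i - g (i + 1) := by
    intro i
    rw [zero_add, h2, map_add, LinearMap.add_apply, hA.derivative, map_smul, hg,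
      ← Int.cast_smul_eq_zsmul ℂ]
    simp only [LinearMap.smul_apply, add_tsub_cancel_right]
    rw [show (-1 - ((i + 1 : ℕ) : ℤ)) = -1 - i - 1 by push_cast; ring, pow_succ]
    push_cast
    module
  rw [hA.skew a u 0]
  simp only [h3]
  rw [finsum_eq_sum_of_support_subset (s := Finset.range (N.toNat + 1)), Finset.sum_range_sub']
  · simp [hg, hN' N.toNat le_rfl]
  · intro i hi
    by_contra hcon
    refine hi ?_
    have hi' : N.toNat + 1 ≤ i := by simpa using hcon
    simp [hg, hN' i (by omega), hN' (i - 1) (by omega)]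

end Extension

/-! ### Unitarity -/

section Unitary

variable {V : Type*} [AddCommGroup V] [Module ℂ V] {A : PreVOA V}

theorem UnitaryStructure.form_self_ne_zero (U : A.UnitaryStructure) {v : V} (hv : v ≠ 0) :
    U.form v v ≠ 0 := fun h => by
  have := U.posDef v hv
  rw [h] at this
  simp at this

theorem UnitaryStructure.φ_mem_weight (U : A.UnitaryStructure) {n : ℤ} {a : V}
    (ha : a ∈ A.weight n) : U.φ a ∈ A.weight n := by
  rw [mem_weight_iff] at ha ⊢
  have := congrArg U.φ ha
  rw [L_apply, U.φ_mode, U.φ_conf, LinearMap.map_smulₛₗ] at this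
  rw [L_apply, this]
  simp

/-- ω is quasi-primary, so only j = 0 contributes to the invariance identity. -/
theorem UnitaryStructure.form_L_one (U : A.UnitaryStructure) (hA : A.IsVOA) (u v : V) :
    U.form (A.L 1 u) v = U.form u (A.L (-1) v) := by
  have h := U.invariant 2 0 A.conf hA.conf_mem_weight u v
  rw [finsum_eq_single _ 0] at h
  · rw [U.φ_conf] at h
    simpa [L_apply] using h
  · intro j hj
    obtain ⟨k, rfl⟩ := Nat.exists_eq_succ_of_ne_zero hj
    rw [Nat.succ_eq_add_one, pow_succ, Module.End.mul_apply, hA.L_one_conf]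
    simp

/-- L(1)a is a multiple of 𝟏, and its pairing with 𝟏 equals (a, L(-1)𝟏) = 0. -/
theorem UnitaryStructure.L_one_eq_zero (U : A.UnitaryStructure) (hA : A.IsVOA)
    (hcft : A.IsCFTType) {a : V} (ha : a ∈ A.weight 1) : A.L 1 a = 0 := by
  have h1 : A.L 1 a ∈ A.weight 0 := by
    have := hA.mode_mem_weight hA.conf_mem_weight ha 2
    norm_num at this
    exact this
  rw [hcft.weight_zero] at h1
  obtain ⟨z, hz⟩ := Submodule.mem_span_singleton.1 h1
  have h2 := U.form_L_one hA a A.vac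
  rw [hA.L_neg_one_vac, map_zero, ← hz, map_smul, LinearMap.smul_apply, smul_eq_mul,
    mul_eq_zero] at h2
  rw [← hz, h2.resolve_right (U.form_self_ne_zero hcft.vac_ne_zero), zero_smul]

theorem UnitaryStructure.form_mode (U : A.UnitaryStructure) (hA : A.IsVOA)
    (hcft : A.IsCFTType) {a : V} (ha : a ∈ A.weight 1) (m : ℤ) (u v : V) :
    U.form u (mode A.Y m (U.φ a) v) = -U.form (mode A.Y (-m) a u) v := by
  rw [← U.invariant 1 m a ha u v, finsum_eq_single _ 0]
  · simp
  · intro j hj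
    obtain ⟨k, rfl⟩ := Nat.exists_eq_succ_of_ne_zero hj
    rw [Nat.succ_eq_add_one, pow_succ, Module.End.mul_apply, U.L_one_eq_zero hA hcft ha]
    simp

/-- A primary vector of weight one with vanishing zero mode which generates a Heisenberg algebra,
and on which the adjoint is given by a multiple. -/
structure IsBoson (A : PreVOA V) (U : A.UnitaryStructure) (w : V) : Prop where
  mem_weight : w ∈ A.weight 1
  zero_mode : ∀ a, mode A.Y 0 w a = 0
  one_mode : mode A.Y 1 w w = A.vac
  φ_eq : ∃ c : ℂ, U.φ w = c • w

theorem isBoson_of_mem_span (U : A.UnitaryStructure) (hcft : A.IsCFTType)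
    {x w : V} (hx : x ∈ A.weight 1) (h0 : ∀ a, mode A.Y 0 x a = 0) {ε : ℂ}
    (hφ : U.φ x = ε • x) (hw : w ∈ Submodule.span ℂ {x}) (h1 : mode A.Y 1 w w = A.vac) :
    A.IsBoson U w := by
  obtain ⟨c, rfl⟩ := Submodule.mem_span_singleton.1 hw
  have hc : c ≠ 0 := by
    rintro rfl
    rw [zero_smul, map_zero] at h1
    exact hcft.vac_ne_zero h1.symm
  refine ⟨Submodule.smul_mem _ _ hx, fun a => ?_, h1, starRingEnd ℂ c * ε * c⁻¹, ?_⟩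
  · rw [map_smul, LinearMap.smul_apply, h0, smul_zero]
  · rw [LinearMap.map_smulₛₗ, hφ, smul_smul, smul_smul, mul_assoc _ _ c, inv_mul_cancel₀ hc,
      mul_one]

/-- Write x_1 x = z𝟏. Invariance gives (x, φ(x)) = -z(𝟏, 𝟏), and φ(x) = εx with (x, x) ≠ 0 forces z
≠ 0. A complex square root of 1/z then normalizes x. -/
theorem exists_normalization (U : A.UnitaryStructure) (hA : A.IsVOA) (hcft : A.IsCFTType)
    {x : V} (hx : x ∈ A.weight 1) (hx0 : x ≠ 0) {ε : ℂ} (hε : ε ≠ 0) (hφ : U.φ x = ε • x) :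
    ∃ w ∈ Submodule.span ℂ {x}, mode A.Y 1 w w = A.vac := by
  have h1 : mode A.Y 1 x x ∈ A.weight 0 := by
    have := hA.mode_mem_weight hx hx 1
    norm_num at this
    exact this
  rw [hcft.weight_zero] at h1
  obtain ⟨z, hz⟩ := Submodule.mem_span_singleton.1 h1
  have hz0 : z ≠ 0 := by
    rintro rfl
    have h2 := U.form_mode hA hcft hx (-1) x A.vac
    rw [hA.creation, neg_neg, ← hz, zero_smul, map_zero, LinearMap.zero_apply, neg_zero, hφ,
      LinearMap.map_smulₛₗ, smul_eq_mul, mul_eq_zero] at h2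
    exact h2.elim (by simpa using hε) (U.form_self_ne_zero hx0)
  obtain ⟨c, hc⟩ := IsAlgClosed.exists_pow_nat_eq z⁻¹ two_pos
  refine ⟨c • x, Submodule.smul_mem _ _ (Submodule.mem_span_singleton_self x), ?_⟩
  rw [map_smul, map_smul, LinearMap.smul_apply, ← hz, smul_smul, smul_smul, ← pow_two, hc,
    inv_mul_cancel₀ hz0, one_smul]

theorem UnitaryStructure.zero_mode_φ (U : A.UnitaryStructure) {u : V}
    (h0 : ∀ a, mode A.Y 0 u a = 0) (a : V) : mode A.Y 0 (U.φ u) a = 0 := by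
  rw [← U.φ_φ a, ← U.φ_mode, h0, map_zero]

theorem IsNormalized.isBoson {U : A.UnitaryStructure} {u w : V} (hw : A.IsNormalized U u w)
    (hcft : A.IsCFTType) (hu : u ∈ A.weight 1) (h0 : ∀ a, mode A.Y 0 u a = 0) :
    A.IsBoson U w := by
  rcases hw with ⟨hw | hw, h1⟩
  · refine isBoson_of_mem_span U hcft (add_mem hu (U.φ_mem_weight hu)) (fun a => ?_) (ε := 1) ?_
      hw h1
    · rw [map_add, LinearMap.add_apply, h0, U.zero_mode_φ h0, add_zero]
    · rw [map_add, U.φ_φ, one_smul, add_comm]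
  · refine isBoson_of_mem_span U hcft (sub_mem hu (U.φ_mem_weight hu)) (fun a => ?_) (ε := -1) ?_
      hw h1
    · rw [map_sub, LinearMap.sub_apply, h0, U.zero_mode_φ h0, sub_zero]
    · rw [map_sub, U.φ_φ, neg_one_smul, neg_sub]

theorem exists_isNormalized (U : A.UnitaryStructure) (hA : A.IsVOA) (hcft : A.IsCFTType)
    {u : V} (hu : u ∈ A.weight 1) (hu0 : u ≠ 0) : ∃ w, A.IsNormalized U u w := by
  by_cases h : u + U.φ u = 0
  · have h2 : u - U.φ u ≠ 0 := by
      intro h3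
      have : (2 : ℂ) • u = 0 := by
        calc (2 : ℂ) • u = (u + U.φ u) + (u - U.φ u) := by rw [two_smul]; abel
          _ = 0 := by rw [h, h3, add_zero]
      exact hu0 ((smul_eq_zero.1 this).resolve_left two_ne_zero)
    obtain ⟨w, hw, h1⟩ := exists_normalization U hA hcft (sub_mem hu (U.φ_mem_weight hu)) h2
      (ε := -1) (by norm_num) (by rw [map_sub, U.φ_φ, neg_one_smul, neg_sub])
    exact ⟨w, Or.inr hw, h1⟩
  · obtain ⟨w, hw, h1⟩ := exists_normalization U hA hcft (add_mem hu (U.φ_mem_weight hu)) h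
      (ε := 1) one_ne_zero (by rw [map_add, U.φ_φ, one_smul, add_comm])
    exact ⟨w, Or.inl hw, h1⟩

theorem IsBoson.isCentral {U : A.UnitaryStructure} {w : V} (hw : A.IsBoson U w) :
    A.IsCentral w :=
  ⟨hw.mem_weight, fun v _ => hw.zero_mode v⟩

end Unitary

/-! ### The action of the Fock space -/

section Boson

variable {V : Type*} [AddCommGroup V] [Module ℂ V] {A : PreVOA V} {U : A.UnitaryStructure} {w : V}

theorem IsCFTType.eq_zero_of_neg (hcft : A.IsCFTType) {n : ℤ} (hn : n < 0) {a : V}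
    (ha : a ∈ A.weight n) : a = 0 := by
  rw [hcft.weight_neg n hn] at ha
  exact ha

theorem IsBoson.mode_self (hw : A.IsBoson U w) (hA : A.IsVOA) (hcft : A.IsCFTType) (n : ℕ) :
    mode A.Y n w w = if n = 1 then A.vac else 0 := by
  rcases n with _ | _ | n
  · simpa using hw.zero_mode w
  · simpa using hw.one_mode
  · rw [if_neg (by omega)]
    exact hcft.eq_zero_of_neg (by push_cast; omega)
      (hA.mode_mem_weight hw.mem_weight hw.mem_weight _)

/-- In the commutator formula w_0 w = 0, w_1 w = 𝟏, and w_i w has negative weight for i ≥ 2; only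
the central term is left. -/
theorem IsBoson.comm (hw : A.IsBoson U w) (hA : A.IsVOA) (hcft : A.IsCFTType) (m n : ℤ) (x : V) :
    mode A.Y m w (mode A.Y n w x) =
      mode A.Y n w (mode A.Y m w x) + if m + n = 0 then (m : ℂ) • x else 0 := by
  rw [← sub_eq_iff_eq_add', hA.isModule.commutator_eq_sum w w x m n 2]
  · rw [Finset.sum_range_succ, Finset.sum_range_one, hw.mode_self hA hcft, hw.mode_self hA hcft,
      if_neg (by norm_num), if_pos rfl]
    have hv : mode A.Y (m + n - (1 : ℕ)) A.vac x = if m + n - (1 : ℕ) = -1 then x else 0 :=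
      hA.vacuum _ _
    rw [hv, Ring.choose_one_right]
    by_cases h : m + n = 0
    · rw [if_pos (by simp [h]), if_pos h, Int.cast_smul_eq_zsmul]
      simp
    · rw [if_neg (by simpa using h), if_neg h]
      simp
  · intro i hi
    rw [hw.mode_self hA hcft, if_neg (by omega), smul_zero]

/-- The creation operators `w_{-k-1}` turn `V` into a module over the polynomial ring. -/
def fockAct (A : PreVOA V) (w : V) : Fock →ₗ[ℂ] Module.End ℂ V :=
  (MvPolynomial.basisMonomials ℕ ℂ).constr ℂ fun s =>
    ((Finsupp.toMultiset s).sort (· ≤ ·)).foldr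
      (fun (k : ℕ) T => mode A.Y (-(k : ℤ) - 1) w * T) 1

theorem fockAct_monomial (s : ℕ →₀ ℕ) :
    A.fockAct w (MvPolynomial.monomial s 1) =
      ((Finsupp.toMultiset s).sort (· ≤ ·)).foldr
        (fun (k : ℕ) T => mode A.Y (-(k : ℤ) - 1) w * T) 1 := by
  rw [← congrFun (MvPolynomial.coe_basisMonomials ℕ ℂ) s]
  exact Module.Basis.constr_basis _ _ _ _

theorem fockAct_one : A.fockAct w 1 = 1 := by
  have := fockAct_monomial (A := A) (w := w) 0
  simpa using this

theorem fockAct_C (z : ℂ) : A.fockAct w (MvPolynomial.C z) = z • 1 := by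
  rw [← mul_one (MvPolynomial.C z), ← MvPolynomial.smul_eq_C_mul, map_smul, fockAct_one]

theorem IsBoson.fockAct_X_mul (hw : A.IsBoson U w) (hA : A.IsVOA) (hcft : A.IsCFTType) (k : ℕ)
    (p : Fock) : A.fockAct w (MvPolynomial.X k * p) =
      mode A.Y (-(k : ℤ) - 1) w * A.fockAct w p := by
  have key : A.fockAct w ∘ₗ LinearMap.mulLeft ℂ (MvPolynomial.X k) =
      LinearMap.mulLeft ℂ (mode A.Y (-(k : ℤ) - 1) w) ∘ₗ A.fockAct w := by
    refine (MvPolynomial.basisMonomials ℕ ℂ).ext fun s => ?_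
    rw [MvPolynomial.coe_basisMonomials, LinearMap.comp_apply, LinearMap.comp_apply,
      LinearMap.mulLeft_apply, LinearMap.mulLeft_apply]
    have e : (MvPolynomial.X k * MvPolynomial.monomial s 1 : Fock) =
        MvPolynomial.monomial (Finsupp.single k 1 + s) 1 := by
      rw [MvPolynomial.X, MvPolynomial.monomial_mul, one_mul]
    rw [e, fockAct_monomial, fockAct_monomial]
    -- Creation operators commute, so inserting k into the sorted list may be done at the front.
    have : LeftCommutative (fun (k : ℕ) (T : Module.End ℂ V) =>
        mode A.Y (-(k : ℤ) - 1) w * T) := ⟨fun i j T => by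
      ext x
      simp only [Module.End.mul_apply]
      rw [hw.comm hA hcft, if_neg (by omega), add_zero]⟩
    have hp : List.Perm ((Finsupp.toMultiset (Finsupp.single k 1 + s)).sort (· ≤ ·))
        (k :: (Finsupp.toMultiset s).sort (· ≤ ·)) := by
      rw [← Multiset.coe_eq_coe, ← Multiset.cons_coe, Multiset.sort_eq, Multiset.sort_eq]
      simp
    rw [hp.foldr_eq]
    rfl
  exact congrArg (fun f => f p) key

theorem heisenbergMode_neg (k : ℕ) (p : Fock) :
    heisenbergMode (-(k : ℤ) - 1) p = MvPolynomial.X k * p := by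
  rw [heisenbergMode, if_pos (by omega), show (-(-(k : ℤ) - 1) - 1).toNat = k by omega]
  rfl

theorem heisenbergMode_succ (k : ℕ) (p : Fock) :
    heisenbergMode ((k : ℤ) + 1) p = ((k : ℂ) + 1) • MvPolynomial.pderiv k p := by
  rw [heisenbergMode, if_neg (by omega), show ((k : ℤ) + 1 - 1).toNat = k by omega]
  push_cast
  rfl

theorem heisenbergMode_zero (p : Fock) : heisenbergMode 0 p = 0 := by
  rw [heisenbergMode, if_neg (by omega)]
  simp

/-- An annihilation operator acts on products of creation operators as a derivation, by the
Heisenberg relations. -/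
theorem IsBoson.mode_succ_fockAct (hw : A.IsBoson U w) (hA : A.IsVOA) (hcft : A.IsCFTType)
    (k : ℕ) (p : Fock) (x : V) :
    mode A.Y ((k : ℤ) + 1) w (A.fockAct w p x) =
      A.fockAct w p (mode A.Y ((k : ℤ) + 1) w x) +
        A.fockAct w (heisenbergMode ((k : ℤ) + 1) p) x := by
  simp only [heisenbergMode_succ]
  induction p using MvPolynomial.induction_on with
  | C z => simp [fockAct_C]
  | add p q hp hq =>
    simp only [map_add, LinearMap.add_apply, smul_add, hp, hq]
    abel
  | mul_X p j hp =>
    rw [mul_comm p, hw.fockAct_X_mul hA hcft, Module.End.mul_apply, Module.End.mul_apply,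
      hw.comm hA hcft, hp, MvPolynomial.pderiv_mul, smul_add, map_add (A.fockAct w),
      LinearMap.add_apply, map_add, ← mul_smul_comm _ (MvPolynomial.X j) (MvPolynomial.pderiv k p), hw.fockAct_X_mul hA hcft, Module.End.mul_apply]
    by_cases h : j = k
    · subst h
      rw [if_pos (by ring), MvPolynomial.pderiv_X_self, one_mul, map_smul (A.fockAct w) _ p,
        LinearMap.smul_apply]
      push_cast
      abel
    · rw [if_neg (by omega), MvPolynomial.pderiv_X_of_ne (by exact h)]
      simp

theorem IsBoson.mode_fockAct (hw : A.IsBoson U w) (hA : A.IsVOA) (hcft : A.IsCFTType) {v : V}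
    (hv : ∀ n : ℤ, 0 ≤ n → mode A.Y n w v = 0) (n : ℤ) (p : Fock) :
    mode A.Y n w (A.fockAct w p v) = A.fockAct w (heisenbergMode n p) v := by
  rcases lt_trichotomy n 0 with hn | rfl | hn
  · obtain ⟨k, rfl⟩ : ∃ k : ℕ, n = -k - 1 := ⟨(-n - 1).toNat, by omega⟩
    rw [heisenbergMode_neg, hw.fockAct_X_mul hA hcft]
    rfl
  · rw [heisenbergMode_zero, hw.zero_mode]
    simp
  · obtain ⟨k, rfl⟩ : ∃ k : ℕ, n = k + 1 := ⟨(n - 1).toNat, by omega⟩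
    rw [hw.mode_succ_fockAct hA hcft, hv _ (by omega), map_zero, zero_add]

theorem ncoeff_residueProduct {M : Type*} [AddCommGroup M] [Module ℂ M] (S T : VertexOperator ℂ M)
    (l n : ℤ) (x : M) :
    VertexOperator.ncoeff (residueProduct S T l) n x = ∑ᶠ i : ℕ, ((-1) ^ i * Ring.choose l i) •
      (VertexOperator.ncoeff S (l - i) (VertexOperator.ncoeff T (n + i) x) -
        ((Int.negOnePow l : ℤˣ) : ℤ) •
          VertexOperator.ncoeff T (n + l - i) (VertexOperator.ncoeff S i x)) := by
  exact congrArg (fun f => f x) (ncoeff_fieldOfModes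
    (fun n => sumLin _ (residueProduct_finite S T l n)) (residueProduct_truncation S T l) n)

theorem ncoeff_heisenbergField (n : ℤ) :
    VertexOperator.ncoeff heisenbergField n = heisenbergMode n :=
  ncoeff_fieldOfModes _ _ _

theorem mode_heisenberg_monomial (s : ℕ →₀ ℕ) (n : ℤ) :
    mode heisenberg.Y n (MvPolynomial.monomial s 1) =
      VertexOperator.ncoeff (((Finsupp.toMultiset s).sort (· ≤ ·)).foldr
        (fun (k : ℕ) B => residueProduct heisenbergField B (-(k : ℤ) - 1)) (idField Fock)) n := by
  have : heisenberg.Y (MvPolynomial.monomial s 1) =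
      ((Finsupp.toMultiset s).sort (· ≤ ·)).foldr
        (fun (k : ℕ) B => residueProduct heisenbergField B (-(k : ℤ) - 1)) (idField Fock) := by
    rw [← congrFun (MvPolynomial.coe_basisMonomials ℕ ℂ) s]
    exact Module.Basis.constr_basis _ _ _ _
  rw [← this]
  rfl

/-- The associativity formula for the modes of w_{-k-1}b is the defining formula of
`residueProduct`. Both sides are built by the same `foldr`, so they agree by induction on the list,
with `IsBoson.mode_fockAct` for each single boson. -/
theorem IsBoson.mode_fockAct_fockAct (hw : A.IsBoson U w) (hA : A.IsVOA) (hcft : A.IsCFTType)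
    {v : V} (hv : ∀ n : ℤ, 0 ≤ n → mode A.Y n w v = 0) (n : ℤ) (p q : Fock) :
    mode A.Y n (A.fockAct w p A.vac) (A.fockAct w q v) =
      A.fockAct w (mode heisenberg.Y n p q) v := by
  have list : ∀ (l : List ℕ) (n : ℤ) (q : Fock),
      mode A.Y n ((l.foldr (fun (k : ℕ) T => mode A.Y (-(k : ℤ) - 1) w * T) 1) A.vac)
        (A.fockAct w q v) = A.fockAct w (VertexOperator.ncoeff (l.foldr
        (fun (k : ℕ) B => residueProduct heisenbergField B (-(k : ℤ) - 1)) (idField Fock)) n q)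
        v := by
    intro l
    induction l with
    | nil =>
      intro n q
      have h1 : mode A.Y n A.vac (A.fockAct w q v) = if n = -1 then A.fockAct w q v else 0 :=
        hA.vacuum _ _
      rw [List.foldr_nil, List.foldr_nil, Module.End.one_apply, h1, idField, ncoeff_fieldOfModes]
      split_ifs <;> simp
    | cons k l ih =>
      intro n q
      rw [List.foldr_cons, List.foldr_cons, Module.End.mul_apply, hA.isModule.associator,
        ncoeff_residueProduct]
      have hfin := residueProduct_finite heisenbergField (l.foldr
        (fun (k : ℕ) B => residueProduct heisenbergField B (-(k : ℤ) - 1)) (idField Fock))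
        (-(k : ℤ) - 1) n q
      have hmap := AddMonoidHom.map_finsum ((A.fockAct w).flip v).toAddMonoidHom hfin
      refine Eq.trans (finsum_congr fun i => ?_) hmap.symm
      simp only [LinearMap.toAddMonoidHom_coe, LinearMap.flip_apply, LinearMap.smul_apply,
        LinearMap.sub_apply, Module.End.mul_apply, map_zsmul, map_sub, ← ih,
        ncoeff_heisenbergField, ← hw.mode_fockAct hA hcft hv]
  have key : (mode A.Y n).flip (A.fockAct w q v) ∘ₗ (A.fockAct w).flip A.vac =
      (A.fockAct w).flip v ∘ₗ (mode heisenberg.Y n).flip q := by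
    refine (MvPolynomial.basisMonomials ℕ ℂ).ext fun s => ?_
    rw [MvPolynomial.coe_basisMonomials]
    change mode A.Y n (A.fockAct w (MvPolynomial.monomial s 1) A.vac) (A.fockAct w q v) =
      A.fockAct w (mode heisenberg.Y n (MvPolynomial.monomial s 1) q) v
    rw [fockAct_monomial, list, mode_heisenberg_monomial]
  exact congrArg (fun f => f p) key

/-- The image of the Fock space is closed under all modes by `IsBoson.mode_fockAct_fockAct`;
conversely it is reached from 𝟏 by modes of w. -/
theorem IsBoson.VA_eq_range (hw : A.IsBoson U w) (hA : A.IsVOA) (hcft : A.IsCFTType) :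
    A.VA w = LinearMap.range ((A.fockAct w).flip A.vac) := by
  have hvac : ∀ n : ℤ, 0 ≤ n → mode A.Y n w A.vac = 0 := hA.creation_nonneg w
  have hX : A.fockAct w (MvPolynomial.X 0) A.vac = w := by
    rw [← mul_one (MvPolynomial.X 0), hw.fockAct_X_mul hA hcft, fockAct_one]
    simpa using hA.creation w
  apply le_antisymm
  · refine sInf_le ⟨⟨⟨1, ?_⟩, ?_⟩, ⟨MvPolynomial.X 0, hX⟩⟩
    · rw [LinearMap.flip_apply, fockAct_one, Module.End.one_apply]
    · rintro n _ ⟨p, rfl⟩ _ ⟨q, rfl⟩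
      exact ⟨mode heisenberg.Y n p q, (hw.mode_fockAct_fockAct hA hcft hvac n p q).symm⟩
  · rintro _ ⟨p, rfl⟩
    rw [LinearMap.flip_apply]
    induction p using MvPolynomial.induction_on with
    | C z =>
      rw [fockAct_C]
      exact Submodule.smul_mem _ _ (A.isSubVA_VA w).vac_mem
    | add p q hp hq =>
      rw [map_add]
      exact Submodule.add_mem _ hp hq
    | mul_X p k hp =>
      rw [mul_comm, hw.fockAct_X_mul hA hcft]
      exact (A.isSubVA_VA w).mode_mem _ _ (A.mem_VA w) _ hp

end Boson

/-! ### Vertex operator subalgebras -/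

section Sub

variable {V : Type*} [AddCommGroup V] [Module ℂ V] {A : PreVOA V}

theorem IsVertexAlgebra.sub (hA : A.IsVertexAlgebra) (S : Submodule ℂ V) (hS : A.IsSubVA S)
    (ω' : V) (hω : ω' ∈ S) : (A.sub S hS ω' hω).IsVertexAlgebra where
  vacuum n x := Subtype.ext <| by
    have : mode A.Y n A.vac (x : V) = if n = -1 then (x : V) else 0 := hA.vacuum n x
    rw [mode_sub]
    change mode A.Y n A.vac (x : V) = _
    rw [this]
    split_ifs <;> rfl
  creation a := Subtype.ext <| by
    rw [mode_sub]
    exact hA.creation a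
  creation_nonneg a n hn := Subtype.ext <| by
    rw [mode_sub]
    exact hA.creation_nonneg a n hn
  borcherds a b x l m n := Subtype.ext <| by
    have h1 := fun (f : ℕ → S) => AddMonoidHom.map_finsum_of_injective S.subtype.toAddMonoidHom
      Subtype.val_injective f
    simp only [LinearMap.toAddMonoidHom_coe, Submodule.subtype_apply] at h1
    rw [h1, h1]
    simp only [Submodule.coe_smul_of_tower, Submodule.coe_sub, mode_sub]
    exact hA.borcherds a b x l m n

theorem choose_three (m : ℤ) : ((Ring.choose (m + 1) 3 : ℤ) : ℂ) = ((m : ℂ) ^ 3 - m) / 6 := by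
  have h := Ring.descPochhammer_eq_factorial_smul_choose (m + 1) 3
  have h2 : (descPochhammer ℤ 3).smeval (m + 1) = m ^ 3 - m := by
    rw [← Polynomial.eval_eq_smeval]
    simp [descPochhammer]
    ring
  rw [h2] at h
  have h3 := congrArg (fun z : ℤ => (z : ℂ)) h
  simp only [nsmul_eq_mul] at h3
  push_cast at h3
  rw [h3]
  norm_num [Nat.factorial]

/-- A vertex subalgebra on which the modes of `ω'` and of the conformal vector agree is a vertex
operator algebra with conformal vector `ω'`. -/
theorem IsVOA.sub (hA : A.IsVOA) (hcft : A.IsCFTType) (S : Submodule ℂ V) (hS : A.IsSubVA S)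
    (ω' : V) (hω : ω' ∈ S) (h : ∀ a ∈ S, ∀ n : ℤ, 0 ≤ n → mode A.Y n ω' a = mode A.Y n A.conf a)
    (h2 : ω' ∈ A.weight 2) (h1 : A.L 1 ω' = 0) : (A.sub S hS ω' hω).IsVOA := by
  have hL : ∀ (n : ℤ) (a : S), (((A.sub S hS ω' hω).L n a : S) : V) = mode A.Y (n + 1) ω' a :=
    fun n a => mode_sub A S hS ω' hω (n + 1) _ a
  have hL0 : ∀ a : S, (((A.sub S hS ω' hω).L 0 a : S) : V) = A.L 0 a := fun a => by
    rw [hL, h a a.2 _ (by norm_num)]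
    rfl
  have hweight : ∀ (n : ℤ) (a : S), a ∈ (A.sub S hS ω' hω).weight n ↔ (a : V) ∈ A.weight n :=
    fun n a => by rw [mem_weight_iff, mem_weight_iff, ← hL0, Subtype.ext_iff]; rfl
  refine ⟨hA.toIsVertexAlgebra.sub S hS ω' hω, ?_, ?_, ?_, ?_, ?_⟩
  · have h3 : mode A.Y 3 ω' ω' ∈ A.weight 0 := by
      have := hA.mode_mem_weight h2 h2 3
      norm_num at this
      exact this
    rw [hcft.weight_zero] at h3
    obtain ⟨z, hz⟩ := Submodule.mem_span_singleton.1 h3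
    -- The central charge is read off from ω'_3 ω' = (c/2)𝟏.
    refine ⟨2 * z, fun m n => ?_⟩
    ext a
    have hc := hA.isModule.commutator_eq_sum ω' ω' a (m + 1) (n + 1) 4 (by
      intro i hi
      rw [hcft.eq_zero_of_neg (by omega) (hA.mode_mem_weight h2 h2 i), smul_zero])
    simp only [Finset.sum_range_succ, Finset.sum_range_zero] at hc
    have e0 : mode A.Y (0 : ℕ) ω' ω' = A.L (-1) ω' := h ω' hω _ (by simp)
    have e1 : mode A.Y (1 : ℕ) ω' ω' = (2 : ℂ) • ω' := by
      rw [h ω' hω _ (by simp)]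
      exact mem_weight_iff.1 h2
    have e2 : mode A.Y (2 : ℕ) ω' ω' = 0 := by
      rw [h ω' hω _ (by simp)]
      exact h1
    have e3 : mode A.Y (3 : ℕ) ω' ω' = z • A.vac := hz.symm
    have hv : mode A.Y (m + 1 + (n + 1) - (3 : ℕ)) A.vac (a : V) = if m + n = 0 then (a : V)
        else 0 := by
      have : mode A.Y (m + 1 + (n + 1) - (3 : ℕ)) A.vac (a : V) =
        if m + 1 + (n + 1) - (3 : ℕ) = -1 then (a : V) else 0 := hA.vacuum _ _
      rw [this]
      by_cases hmn : m + n = 0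
      · rw [if_pos hmn, if_pos (by push_cast; omega)]
      · rw [if_neg hmn, if_neg (by push_cast; omega)]
    rw [e0, e1, e2, e3, hA.derivative, map_smul, map_smul, LinearMap.smul_apply,
      LinearMap.smul_apply, LinearMap.smul_apply, hv] at hc
    simp only [map_zero, LinearMap.zero_apply, smul_zero, add_zero, zero_add,
      Ring.choose_zero_right, one_smul, Ring.choose_one_right] at hc
    simp only [LinearMap.sub_apply, Module.End.mul_apply, LinearMap.add_apply,
      LinearMap.smul_apply, Module.End.one_apply, Submodule.coe_sub, Submodule.coe_add,
      Submodule.coe_smul, hL]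
    rw [hc, ← Int.cast_smul_eq_zsmul ℂ, ← Int.cast_smul_eq_zsmul ℂ, choose_three,
      show m + 1 + (n + 1) - ((0 : ℕ) : ℤ) - 1 = m + n + 1 by push_cast; ring,
      show m + 1 + (n + 1) - ((1 : ℕ) : ℤ) = m + n + 1 by push_cast; ring]
    by_cases hmn : m + n = 0
    · rw [if_pos hmn, if_pos hmn]
      push_cast
      module
    · rw [if_neg hmn, if_neg hmn]
      push_cast
      module
  · intro a n
    ext b
    rw [mode_sub, hL, h a a.2 _ (by norm_num), LinearMap.smul_apply, Submodule.coe_smul, mode_sub]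
    exact congrArg (fun f => f (b : V)) (hA.derivative a n)
  · refine DirectSum.isInternal_submodule_of_iSupIndep_of_iSup_eq_top ?_ ?_
    · exact (Module.End.eigenspaces_iSupIndep _).comp (f := fun n : ℤ => (n : ℂ))
        Int.cast_injective
    · rw [eq_top_iff]
      rintro a -
      -- L(0) agrees with a mode of ω' on `S`, so it preserves `S` and homogeneous components stay
      -- in `S`.
      have hS0 : ∀ x ∈ S, A.L 0 x ∈ S := fun x hx => by
        rw [← hL0 ⟨x, hx⟩]
        exact Subtype.property _
      obtain ⟨s, f, hf, hfS, ha⟩ := hA.exists_sum_weight_of_mem hS0 a.2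
      have ha' : a = ∑ n ∈ s.attach, (⟨f n, hfS n n.2⟩ : S) := by
        apply Subtype.ext
        rw [ha, Submodule.coe_sum, ← Finset.sum_attach]
      rw [ha']
      exact Submodule.sum_mem _ fun n _ =>
        Submodule.mem_iSup_of_mem (n : ℤ) ((hweight _ _).2 (hf n))
  · intro n
    have := hA.finite n
    exact FiniteDimensional.of_injective
      ((S.subtype ∘ₗ ((A.sub S hS ω' hω).weight n).subtype).codRestrict (A.weight n)
        fun a => (hweight n a).1 a.2)
      (fun a b hab => Subtype.ext (Subtype.ext (congrArg (fun z : A.weight n => (z : V)) hab)))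
  · obtain ⟨N, hN⟩ := hA.bounded
    refine ⟨N, fun n hn => ?_⟩
    rw [eq_bot_iff]
    intro a ha
    have := (hweight n a).1 ha
    rw [hN n hn] at this
    exact Subtype.ext this

end Sub

/-! ### The commutant of a boson -/

section Commutant

variable {V : Type*} [AddCommGroup V] [Module ℂ V] {A : PreVOA V} {U : A.UnitaryStructure} {w : V}

/-- By skew symmetry, being killed by all nonnegative modes is a symmetric relation. So w lies in
the commutant of the line through v, which is a vertex subalgebra and hence contains VA(w). -/
theorem mem_commutant_VA_iff (hA : A.IsVertexAlgebra) {v : V} :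
    v ∈ A.commutant (A.VA w) ↔ ∀ n : ℤ, 0 ≤ n → mode A.Y n w v = 0 := by
  refine ⟨fun h => h w (A.mem_VA w), fun h => ?_⟩
  have h1 : A.VA w ≤ A.commutant (Submodule.span ℂ {v}) := by
    refine sInf_le ⟨A.isSubVA_commutant hA _, fun α hα n hn => ?_⟩
    obtain ⟨z, rfl⟩ := Submodule.mem_span_singleton.1 hα
    rw [map_smul, LinearMap.smul_apply, hA.mode_eq_zero_symm h n hn, smul_zero]
  intro α hα n hn
  exact hA.mode_eq_zero_symm (fun k hk => h1 hα v (Submodule.mem_span_singleton_self v) k hk) n hn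

theorem IsBoson.mode_neg_one_self (hw : A.IsBoson U w) (hA : A.IsVOA) (hcft : A.IsCFTType)
    (n : ℕ) : mode A.Y n w (A.confOf w) = if n = 1 then w else 0 := by
  rw [confOf, map_smul, hw.comm hA hcft, hw.mode_self hA hcft]
  by_cases h : n = 1
  · subst h
    simp [hA.creation]
    module
  · rw [if_neg h, if_neg h, if_neg (by omega)]
    simp

theorem IsBoson.conf_mode (hw : A.IsBoson U w) (hA : A.IsVOA) (hcft : A.IsCFTType) (n : ℕ)
    (hn : 1 ≤ n) : mode A.Y n A.conf w = if n = 1 then w else 0 := by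
  obtain rfl | rfl | hn : n = 1 ∨ n = 2 ∨ 3 ≤ n := by omega
  · rw [if_pos rfl]
    have := mem_weight_iff.1 hw.mem_weight
    rw [Int.cast_one, one_smul] at this
    exact this
  · rw [if_neg (by norm_num)]
    exact U.L_one_eq_zero hA hcft hw.mem_weight
  · rw [if_neg (by omega)]
    exact hcft.eq_zero_of_neg (by omega) (hA.mode_mem_weight hA.conf_mem_weight hw.mem_weight _)

/-- For n ≥ 1 skew symmetry reduces to the modes of ω on w; n = 0 is separate, since there L(-1)w
would enter, and uses w_0 = 0. -/
theorem IsBoson.mode_conf (hw : A.IsBoson U w) (hA : A.IsVOA) (hcft : A.IsCFTType) (n : ℕ) :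
    mode A.Y n w A.conf = if n = 1 then w else 0 := by
  rcases Nat.eq_zero_or_pos n with rfl | hn
  · rw [if_neg (by norm_num)]
    exact hw.zero_mode _
  · have h : ∀ i : ℕ, mode A.Y ((n : ℤ) + i) A.conf w = if n + i = 1 then w else 0 := fun i => by
      rw [← Nat.cast_add, hw.conf_mode hA hcft (n + i) (by omega)]
    rw [hA.skew A.conf w n]
    simp only [h]
    rw [finsum_eq_single _ 0]
    · by_cases h1 : n = 1
      · subst h1
        simp [hA.creation]
      · simp [h1]
    · intro i hi
      rw [if_neg (by omega)]
      simp

theorem IsBoson.sub_mem_commutant (hw : A.IsBoson U w) (hA : A.IsVOA) (hcft : A.IsCFTType) :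
    A.conf - A.confOf w ∈ A.commutant (A.VA w) := by
  rw [mem_commutant_VA_iff hA.toIsVertexAlgebra]
  intro n hn
  lift n to ℕ using hn
  rw [map_sub, hw.mode_neg_one_self hA hcft, hw.mode_conf hA hcft, sub_self]

theorem IsBoson.confOf_mem_weight (hw : A.IsBoson U w) (hA : A.IsVOA) :
    A.confOf w ∈ A.weight 2 := by
  have := hA.mode_mem_weight hw.mem_weight hw.mem_weight (-1)
  norm_num at this
  exact Submodule.smul_mem _ _ this

/-- Commuting L(1) past w_{-1} produces only multiples of w_0, which is zero, and L(1)w = 0. -/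
theorem IsBoson.L_one_confOf (hw : A.IsBoson U w) (hA : A.IsVOA) (hcft : A.IsCFTType) :
    A.L 1 (A.confOf w) = 0 := by
  have h1 := hA.isModule.commutator_nat A.conf w w 2 (-1)
  have e0 : mode A.Y (0 : ℕ) A.conf w = A.L (-1) w := rfl
  have e1 := hw.conf_mode hA hcft 1 le_rfl
  have e2 := hw.conf_mode hA hcft 2 (by norm_num)
  rw [if_pos rfl] at e1
  rw [if_neg (by norm_num)] at e2
  simp only [Finset.sum_range_succ, Finset.sum_range_zero, e0, e1, e2, hA.derivative,
    LinearMap.smul_apply, map_zero, LinearMap.zero_apply, smul_zero, add_zero, zero_add,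
    sub_zero] at h1
  rw [show ((2 : ℕ) : ℤ) + -1 - ((0 : ℕ) : ℤ) - 1 = 0 by norm_num,
    show ((2 : ℕ) : ℤ) + -1 - ((1 : ℕ) : ℤ) = 0 by norm_num, hw.zero_mode, smul_zero, smul_zero,
    smul_zero, add_zero] at h1
  rw [confOf, map_smul, L_apply, show (1 : ℤ) + 1 = (2 : ℕ) by norm_num, h1, smul_zero]

theorem IsBoson.isVOA_VAVOA (hw : A.IsBoson U w) (hA : A.IsVOA) (hcft : A.IsCFTType) :
    (A.VAVOA w).IsVOA := by
  refine hA.sub hcft _ _ _ _ (fun a ha n hn => ?_) (hw.confOf_mem_weight hA)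
    (hw.L_one_confOf hA hcft)
  have h := hA.mode_eq_zero_symm (hw.sub_mem_commutant hA hcft a ha) n hn
  rw [map_sub, LinearMap.sub_apply, sub_eq_zero] at h
  exact h.symm

theorem IsBoson.isVOA_comVOA (hw : A.IsBoson U w) (hA : A.IsVOA) (hcft : A.IsCFTType)
    (hω : A.conf - A.confOf w ∈ A.commutant (A.VA w)) :
    (A.comVOA hA.toIsVertexAlgebra (A.VA w) (A.conf - A.confOf w) hω).IsVOA := by
  refine hA.sub hcft _ _ _ _ (fun a ha n hn => ?_)
    (sub_mem hA.conf_mem_weight (hw.confOf_mem_weight hA)) ?_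
  · have h := ha (A.confOf w) ?_ n hn
    · rw [map_sub, LinearMap.sub_apply, h, sub_zero]
    · exact Submodule.smul_mem _ _
        ((A.isSubVA_VA w).mode_mem (-1) w (A.mem_VA w) w (A.mem_VA w))
  · rw [map_sub, hA.L_one_conf, hw.L_one_confOf hA hcft, sub_zero]

end Commutant

end PreVOA

/-! ### Linear algebra for the Fock space -/

theorem fock_eq_C_of_pderiv_eq_zero {p : Fock} (hp : ∀ k, MvPolynomial.pderiv k p = 0) :
    p = MvPolynomial.C (MvPolynomial.coeff 0 p) := by
  ext m
  rw [MvPolynomial.coeff_C]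
  by_cases hm : 0 = m
  · rw [if_pos hm, hm]
  · rw [if_neg hm]
    obtain ⟨k, hk⟩ : ∃ k, m k ≠ 0 := by
      by_contra! h
      exact hm (Finsupp.ext fun k => (h k).symm)
    have h1 := congrArg (MvPolynomial.coeff (m - Finsupp.single k 1)) (hp k)
    rw [MvPolynomial.coeff_pderiv, MvPolynomial.coeff_zero, tsub_add_cancel_of_le
      (by simpa [Finsupp.single_le_iff] using Nat.one_le_iff_ne_zero.2 hk)] at h1
    exact (mul_eq_zero.1 h1).resolve_right (Nat.cast_add_one_ne_zero _)

theorem totalDegree_pderiv_le {p : Fock} {N : ℕ} (hp : p.totalDegree ≤ N + 1) (k : ℕ) :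
    (MvPolynomial.pderiv k p).totalDegree ≤ N := by
  refine Finset.sup_le fun m hm => ?_
  have h1 : m + Finsupp.single k 1 ∈ p.support := by
    rw [MvPolynomial.mem_support_iff, MvPolynomial.coeff_pderiv] at hm
    exact MvPolynomial.mem_support_iff.2 (left_ne_zero_of_mul hm)
  have h2 := (MvPolynomial.le_totalDegree h1).trans hp
  rw [Finsupp.sum_add_index' (by simp) (by simp), Finsupp.sum_single_index rfl] at h2
  omega

namespace PreVOA

variable {V : Type*} [AddCommGroup V] [Module ℂ V] {A : PreVOA V} {U : A.UnitaryStructure} {w : V}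

/-- Applying w_{k+1} to a relation differentiates all its coefficients at once in the k-th variable.
By induction on the degree all partial derivatives vanish, so the coefficients are constants, and
linear independence of `b` finishes. -/
theorem IsBoson.eq_zero_of_sum_fockAct_eq_zero (hw : A.IsBoson U w) (hA : A.IsVOA)
    (hcft : A.IsCFTType) {κ : Type*} {b : κ → V} (hb : LinearIndependent ℂ b)
    (hbw : ∀ i, ∀ n : ℤ, 0 ≤ n → mode A.Y n w (b i) = 0) (s : Finset κ) (P : κ → Fock)
    (hP : ∑ i ∈ s, A.fockAct w (P i) (b i) = 0) : ∀ i ∈ s, P i = 0 := by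
  have const : ∀ P : κ → Fock, (∑ i ∈ s, A.fockAct w (P i) (b i) = 0) →
      (∀ i ∈ s, P i = MvPolynomial.C (MvPolynomial.coeff 0 (P i))) → ∀ i ∈ s, P i = 0 := by
    intro P hP hC i hi
    have h1 : ∑ i ∈ s, MvPolynomial.coeff 0 (P i) • b i = 0 := by
      rw [← hP]
      refine Finset.sum_congr rfl fun i hi => ?_
      conv_rhs => rw [hC i hi, fockAct_C]
      rfl
    rw [hC i hi, linearIndependent_iff'.1 hb s _ h1 i hi, map_zero]
  have deg : ∀ (N : ℕ) (P : κ → Fock), (∑ i ∈ s, A.fockAct w (P i) (b i) = 0) →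
      (∀ i ∈ s, (P i).totalDegree ≤ N) → ∀ i ∈ s, P i = 0 := by
    intro N
    induction N with
    | zero =>
      intro P hP hN
      exact const P hP fun i hi =>
        MvPolynomial.totalDegree_eq_zero_iff_eq_C.1 (Nat.le_zero.1 (hN i hi))
    | succ N ih =>
      intro P hP hN
      refine const P hP fun i hi => fock_eq_C_of_pderiv_eq_zero fun k => ?_
      refine ih (fun i => MvPolynomial.pderiv k (P i)) ?_
        (fun i hi => totalDegree_pderiv_le (hN i hi) k) i hi
      have h1 := congrArg (mode A.Y ((k : ℤ) + 1) w) hP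
      rw [map_zero, map_sum] at h1
      have h2 : ((k : ℂ) + 1) • ∑ i ∈ s, A.fockAct w (MvPolynomial.pderiv k (P i)) (b i) = 0 := by
        rw [← h1, Finset.smul_sum]
        refine Finset.sum_congr rfl fun i _ => ?_
        rw [hw.mode_fockAct hA hcft (hbw i), heisenbergMode_succ, map_smul, LinearMap.smul_apply]
      exact (smul_eq_zero.1 h2).resolve_left (by exact_mod_cast Nat.succ_ne_zero k)
  exact deg (s.sup fun i => (P i).totalDegree) P hP fun i hi =>
    Finset.le_sup (f := fun i => (P i).totalDegree) hi

theorem IsBoson.fockAct_vac_injective (hw : A.IsBoson U w) (hA : A.IsVOA) (hcft : A.IsCFTType) :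
    Function.Injective ((A.fockAct w).flip A.vac) := by
  refine (injective_iff_map_eq_zero _).2 fun p hp => ?_
  refine hw.eq_zero_of_sum_fockAct_eq_zero hA hcft (κ := Unit) (b := fun _ => A.vac)
    (LinearIndependent.of_subsingleton () hcft.vac_ne_zero)
    (fun _ => hA.creation_nonneg w) {()} (fun _ => p) ?_ () (Finset.mem_singleton_self _)
  rw [Finset.sum_singleton]
  exact hp

/-! ### Complete reducibility over the Heisenberg algebra -/

/-- A proper subspace of a weight space has a nonzero orthogonal vector. -/
theorem UnitaryStructure.exists_orthogonal (U : A.UnitaryStructure) (hA : A.IsVOA) {n : ℤ}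
    {W : Submodule ℂ V} (hW : ¬ A.weight n ≤ W) :
    ∃ v ∈ A.weight n, v ≠ 0 ∧ ∀ y ∈ A.weight n, y ∈ W → U.form v y = 0 := by
  have := hA.finite n
  -- The arguments are swapped because `inner` is conjugate-linear in its first variable and `form`
  -- in its second.
  let core : InnerProductSpace.Core ℂ (A.weight n) :=
    { inner := fun x y => U.form (y : V) (x : V)
      conj_inner_symm := fun x y => (U.hermitian y x).symm
      re_inner_nonneg := fun x => by
        by_cases hx : (x : V) = 0
        · simp [hx]
        · exact (U.posDef x hx).le
      add_left := fun x y z => by simp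
      smul_left := fun x y r => by simp
      definite := fun x hx => by
        by_contra h
        exact U.form_self_ne_zero (fun e => h (Subtype.ext e)) hx }
  let : NormedAddCommGroup (A.weight n) := core.toNormedAddCommGroup
  let : InnerProductSpace ℂ (A.weight n) := InnerProductSpace.ofCore core.toCore
  have h1 : W.comap (A.weight n).subtype ≠ ⊤ := fun h => hW fun x hx => by
    have : (⟨x, hx⟩ : A.weight n) ∈ W.comap (A.weight n).subtype := by rw [h]; trivial
    exact this
  have h2 : (W.comap (A.weight n).subtype)ᗮ ≠ ⊥ := fun h =>
    h1 (Submodule.orthogonal_eq_bot_iff.1 h)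
  obtain ⟨v, hv, hv0⟩ := (Submodule.ne_bot_iff _).1 h2
  refine ⟨v, v.2, fun e => hv0 (Subtype.ext e), fun y hy hyW => ?_⟩
  exact (Submodule.mem_orthogonal _ _).1 hv ⟨y, hy⟩ hyW

/-- A subspace stable under the Heisenberg algebra which contains all vacuum vectors is
everything. -/
theorem IsBoson.eq_top_of_stable (hw : A.IsBoson U w) (hA : A.IsVOA) (hcft : A.IsCFTType)
    {W : Submodule ℂ V} (hW : ∀ n : ℤ, ∀ x ∈ W, mode A.Y n w x ∈ W)
    (hvac : ∀ v, (∀ n : ℤ, 0 ≤ n → mode A.Y n w v = 0) → v ∈ W) : W = ⊤ := by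
  have key : ∀ d : ℕ, ∀ n : ℤ, n < d → A.weight n ≤ W := by
    intro d
    induction d with
    | zero =>
      intro n hn
      rw [hcft.weight_neg n (by simpa using hn)]
      exact bot_le
    | succ d ih =>
      intro n hn
      by_contra hcon
      obtain ⟨v, hv, hv0, horth⟩ := U.exists_orthogonal hA hcon
      have hvW : v ∈ W := by
        refine hvac v fun k hk => ?_
        rcases hk.eq_or_lt with rfl | hk
        · exact hw.zero_mode v
        · by_contra hx
          have h1 := hA.mode_mem_weight hw.mem_weight hv k
          -- (w_k v, w_k v) is a multiple of (v, w_{-k}w_k v). The weight of w_k v is below n, so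
          -- w_k v lies in `W` by induction; then w_{-k}w_k v lies in `W` in weight n and is
          -- orthogonal to v.
          have h2 := U.form_mode hA hcft hw.mem_weight (-k) v (mode A.Y k w v)
          obtain ⟨c, hc⟩ := hw.φ_eq
          have h3 := hA.mode_mem_weight hw.mem_weight h1 (-k)
          rw [show 1 + (1 + n - k - 1) - -k - 1 = n by ring] at h3
          rw [hc, map_smul, LinearMap.smul_apply, LinearMap.map_smulₛₗ,
            horth _ h3 (hW _ _ (ih _ (by push_cast at hn; omega) h1)), smul_zero, neg_neg,
            eq_comm, neg_eq_zero] at h2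
          exact U.form_self_ne_zero hx h2
      exact U.form_self_ne_zero hv0 (horth v hv hvW)
  rw [eq_top_iff, ← hA.span_weight]
  exact iSup_le fun n => key (n + 1).toNat n (by omega)

/-- The multiplication map from the tensor product of the Fock space and the commutant. -/
def fockTensor (A : PreVOA V) (w : V) : Fock ⊗[ℂ] A.commutant (A.VA w) →ₗ[ℂ] V :=
  TensorProduct.lift (LinearMap.lcomp ℂ V (A.commutant (A.VA w)).subtype ∘ₗ A.fockAct w)

theorem fockTensor_tmul (p : Fock) (b : A.commutant (A.VA w)) :
    A.fockTensor w (p ⊗ₜ b) = A.fockAct w p b := rfl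

/-- For injectivity, expand along a basis of the commutant, whose members are independent vacuum
vectors. For surjectivity, the image is stable under the Heisenberg algebra and contains each vacuum
vector v as the image of 1 ⊗ v. -/
theorem IsBoson.fockTensor_bijective (hw : A.IsBoson U w) (hA : A.IsVOA) (hcft : A.IsCFTType) :
    Function.Bijective (A.fockTensor w) := by
  classical
  constructor
  · refine (injective_iff_map_eq_zero _).2 fun z hz => ?_
    let 𝒞 := Module.Basis.ofVectorSpace ℂ (A.commutant (A.VA w))
    obtain ⟨P, rfl⟩ := (TensorProduct.equivFinsuppOfBasisRight (M := Fock) 𝒞).symm.surjective z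
    rw [LinearEquiv.map_eq_zero_iff]
    rw [TensorProduct.equivFinsuppOfBasisRight_symm_apply, Finsupp.sum, map_sum] at hz
    simp only [fockTensor_tmul] at hz
    have hli : LinearIndependent ℂ fun i => ((𝒞 i : A.commutant (A.VA w)) : V) :=
      𝒞.linearIndependent.map' (A.commutant (A.VA w)).subtype (Submodule.ker_subtype _)
    have := hw.eq_zero_of_sum_fockAct_eq_zero hA hcft hli
      (fun i => (mem_commutant_VA_iff hA.toIsVertexAlgebra).1 (𝒞 i).2) P.support P hz
    ext1 i
    by_cases hi : i ∈ P.support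
    · exact this i hi
    · exact Finsupp.notMem_support_iff.1 hi
  · rw [← LinearMap.range_eq_top]
    refine hw.eq_top_of_stable hA hcft ?_ ?_
    · rintro n _ ⟨z, rfl⟩
      induction z with
      | zero => simp
      | add x y hx hy =>
        rw [map_add, map_add]
        exact add_mem hx hy
      | tmul p b =>
        rw [fockTensor_tmul, hw.mode_fockAct hA hcft
          ((mem_commutant_VA_iff hA.toIsVertexAlgebra).1 b.2)]
        exact ⟨heisenbergMode n p ⊗ₜ b, rfl⟩
    · intro v hv
      refine ⟨1 ⊗ₜ ⟨v, (mem_commutant_VA_iff hA.toIsVertexAlgebra).2 hv⟩, ?_⟩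
      rw [fockTensor_tmul, fockAct_one]
      rfl

end PreVOA

/-- The negative and nonnegative halves of the sum match the two families in the associativity
formula for a (-1)-product. -/
theorem finsum_int_eq {E : Type*} [AddCommGroup E] {G : ℤ → E} (hG : (Function.support G).Finite) :
    ∑ᶠ m, G m = ∑ᶠ i : ℕ, (G (-1 - i) + G i) := by
  have hinj : Function.Injective fun i : ℕ => (-1 - i : ℤ) := fun i j h => by
    simp only [sub_right_inj] at h
    exact_mod_cast h
  have hinj' : Function.Injective fun i : ℕ => (i : ℤ) := Nat.cast_injective
  have hu : (Set.range fun i : ℕ => (-1 - i : ℤ)) ∪ (Set.range fun i : ℕ => (i : ℤ)) =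
      Set.univ := by
    rw [Set.eq_univ_iff_forall]
    intro m
    rcases lt_or_ge m 0 with h | h
    · exact Or.inl ⟨(-1 - m).toNat, by simp only; omega⟩
    · exact Or.inr ⟨m.toNat, by simp only; omega⟩
  rw [finsum_add_distrib (hG.preimage hinj.injOn) (hG.preimage hinj'.injOn),
    ← finsum_mem_range hinj, ← finsum_mem_range hinj', ← finsum_mem_union' _
      (hG.subset Set.inter_subset_right) (hG.subset Set.inter_subset_right), hu, finsum_mem_univ]
  rw [Set.disjoint_left]
  rintro _ ⟨i, rfl⟩ ⟨j, h⟩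
  simp only at h
  omega

namespace PreVOA

variable {V : Type*} [AddCommGroup V] [Module ℂ V] {A : PreVOA V} {U : A.UnitaryStructure} {w : V}

theorem mode_VAVOA (n : ℤ) (a b : A.VA w) :
    ((mode (A.VAVOA w).Y n a b : A.VA w) : V) = mode A.Y n (a : V) b :=
  mode_sub _ _ _ _ _ _ _ _

theorem mode_comVOA (hA : A.IsVertexAlgebra) (S : Submodule ℂ V) (ω' : V)
    (hω : ω' ∈ A.commutant S) (n : ℤ) (a b : A.commutant S) :
    ((mode (A.comVOA hA S ω' hω).Y n a b : A.commutant S) : V) = mode A.Y n (a : V) b :=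
  mode_sub _ _ _ _ _ _ _ _

/-! ### The boson subalgebra is the Heisenberg vertex operator algebra -/

theorem IsBoson.exists_fockEquiv (hw : A.IsBoson U w) (hA : A.IsVOA) (hcft : A.IsCFTType) :
    ∃ f : A.VA w ≃ₗ[ℂ] Fock, ∀ p, ((f.symm p : A.VA w) : V) = A.fockAct w p A.vac :=
  ⟨((LinearEquiv.ofInjective _ (hw.fockAct_vac_injective hA hcft)).trans
    (LinearEquiv.ofEq _ _ (hw.VA_eq_range hA hcft).symm)).symm, fun _ => rfl⟩

theorem IsBoson.isVOAIso_heisenberg (hw : A.IsBoson U w) (hA : A.IsVOA) (hcft : A.IsCFTType)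
    {f : A.VA w ≃ₗ[ℂ] Fock} (hf : ∀ p, ((f.symm p : A.VA w) : V) = A.fockAct w p A.vac) :
    (A.VAVOA w).IsVOAIso heisenberg f where
  map_vac := by
    rw [← LinearEquiv.eq_symm_apply]
    apply Subtype.ext
    rw [hf]
    exact (congrArg (fun T => T A.vac) fockAct_one).symm
  map_conf := by
    rw [← LinearEquiv.eq_symm_apply]
    apply Subtype.ext
    rw [hf]
    change A.confOf w = A.fockAct w (MvPolynomial.C (1 / 2) * MvPolynomial.X 0 ^ 2) A.vac
    have h1 : A.fockAct w (MvPolynomial.X 0 * 1) A.vac = w := by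
      rw [hw.fockAct_X_mul hA hcft, fockAct_one]
      simpa using hA.creation w
    rw [mul_one] at h1
    rw [← MvPolynomial.smul_eq_C_mul, map_smul, pow_two, hw.fockAct_X_mul hA hcft,
      LinearMap.smul_apply, Module.End.mul_apply, h1]
    simp [confOf]
  map_mode n a b := by
    obtain ⟨p, rfl⟩ := f.symm.surjective a
    obtain ⟨q, rfl⟩ := f.symm.surjective b
    rw [← LinearEquiv.eq_symm_apply]
    apply Subtype.ext
    rw [mode_VAVOA, hf, hf, hf, LinearEquiv.apply_symm_apply, LinearEquiv.apply_symm_apply]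
    exact hw.mode_fockAct_fockAct hA hcft (hA.creation_nonneg w) n p q

/-! ### The tensor decomposition -/

/-- The creation property of M(1) is pulled back from V along the injective map p ↦ p·𝟏, then
applied to the vacuum vector v. -/
theorem IsBoson.mode_neg_one_fockAct (hw : A.IsBoson U w) (hA : A.IsVOA) (hcft : A.IsCFTType)
    {v : V} (hv : ∀ n : ℤ, 0 ≤ n → mode A.Y n w v = 0) (p : Fock) :
    mode A.Y (-1) (A.fockAct w p A.vac) v = A.fockAct w p v := by
  have h1 : mode heisenberg.Y (-1) p 1 = p := by
    apply hw.fockAct_vac_injective hA hcft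
    rw [LinearMap.flip_apply, ← hw.mode_fockAct_fockAct hA hcft (hA.creation_nonneg w),
      fockAct_one, Module.End.one_apply, hA.creation, LinearMap.flip_apply]
  have h2 := hw.mode_fockAct_fockAct hA hcft hv (-1) p 1
  rwa [h1, fockAct_one, Module.End.one_apply] at h2

theorem commute_of_mem_commutant (hA : A.IsVertexAlgebra) {S : Submodule ℂ V} {a b : V}
    (ha : a ∈ S) (hb : b ∈ A.commutant S) (m n : ℤ) (x : V) :
    mode A.Y m a (mode A.Y n b x) = mode A.Y n b (mode A.Y m a x) := by
  rw [← sub_eq_zero, A.commutator_formula hA]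
  refine finsum_eq_zero_of_forall_eq_zero fun i => ?_
  rw [hb a ha i (by positivity)]
  simp

theorem mode_mode_neg_one (hA : A.IsVertexAlgebra) {S : Submodule ℂ V} {a c d : V}
    (ha : a ∈ S) (hc : c ∈ S) (hd : d ∈ A.commutant S) (m : ℤ) :
    mode A.Y m a (mode A.Y (-1) c d) = mode A.Y (-1) (mode A.Y m a c) d := by
  rw [hA.isModule.associator, finsum_eq_single _ 0]
  · rw [hd a ha (0 : ℕ) (by simp)]
    simp
  · intro i hi
    rw [hd a ha i (by positivity), hd c hc (-1 + i) (by omega)]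
    simp

/-- Modes of `S` commute with modes of its commutant, so each term of the associativity formula for
a_{-1}b factors; the two families recombine into one sum over ℤ. -/
theorem mode_tensor_map (hA : A.IsVertexAlgebra) {S : Submodule ℂ V} {a b c d : V}
    (ha : a ∈ S) (hb : b ∈ A.commutant S) (hc : c ∈ S) (hd : d ∈ A.commutant S) (n : ℤ) :
    mode A.Y n (mode A.Y (-1) a b) (mode A.Y (-1) c d) =
      ∑ᶠ i : ℤ, mode A.Y (-1) (mode A.Y i a c) (mode A.Y (n - 1 - i) b d) := by
  have hG : (Function.support fun i : ℤ =>
      mode A.Y (-1) (mode A.Y i a c) (mode A.Y (n - 1 - i) b d)).Finite := by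
    obtain ⟨N, hN⟩ := mode_truncation A.Y a c
    obtain ⟨N', hN'⟩ := mode_truncation A.Y b d
    refine (Set.finite_Icc (n - 1 - N') N).subset fun i hi => ?_
    by_contra hcon
    refine hi ?_
    rw [Set.mem_Icc, not_and_or, not_le, not_le] at hcon
    rcases hcon with h | h
    · simp only [hN' (n - 1 - i) (by omega), map_zero]
    · simp only [hN i h.le, map_zero, LinearMap.zero_apply]
  have key : ∀ i k : ℤ, mode A.Y i a (mode A.Y k b (mode A.Y (-1) c d)) =
      mode A.Y (-1) (mode A.Y i a c) (mode A.Y k b d) := by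
    intro i k
    rw [← commute_of_mem_commutant hA hc hb]
    exact mode_mode_neg_one hA ha hc ((A.isSubVA_commutant hA S).mode_mem k b hb d hd) i
  rw [finsum_int_eq hG, hA.isModule.associator]
  refine finsum_congr fun i => ?_
  rw [choose_neg_one, ← mul_pow, ← commute_of_mem_commutant hA ha hb, key, key,
    Int.negOnePow_odd (-1) ⟨-1, rfl⟩]
  rw [show n - 1 - (-1 - (i : ℤ)) = n + i by ring, show n + -1 - (i : ℤ) = n - 1 - i by ring]
  simp

theorem IsBoson.exists_tensorEquiv (hw : A.IsBoson U w) (hA : A.IsVOA) (hcft : A.IsCFTType) :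
    ∃ e : A.VA w ⊗[ℂ] A.commutant (A.VA w) ≃ₗ[ℂ] V,
      ∀ (a : A.VA w) (b : A.commutant (A.VA w)), e (a ⊗ₜ b) = mode A.Y (-1) (a : V) (b : V) := by
  obtain ⟨f, hf⟩ := hw.exists_fockEquiv hA hcft
  refine ⟨(TensorProduct.congr f (LinearEquiv.refl ℂ _)).trans
    (LinearEquiv.ofBijective _ (hw.fockTensor_bijective hA hcft)), fun a b => ?_⟩
  obtain ⟨p, rfl⟩ := f.symm.surjective a
  rw [hf, hw.mode_neg_one_fockAct hA hcft ((mem_commutant_VA_iff hA.toIsVertexAlgebra).1 b.2)]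
  simp [fockTensor_tmul]

theorem isVOAIso_tensor (hA : A.IsVertexAlgebra)
    (hω : A.conf - A.confOf w ∈ A.commutant (A.VA w))
    {e : A.VA w ⊗[ℂ] A.commutant (A.VA w) ≃ₗ[ℂ] V}
    (he : ∀ (a : A.VA w) (b : A.commutant (A.VA w)),
      e (a ⊗ₜ b) = mode A.Y (-1) (a : V) (b : V)) :
    ((A.VAVOA w).tensor (A.comVOA hA (A.VA w) (A.conf - A.confOf w) hω)).IsVOAIso A e where
  map_vac := by
    change e ((A.VAVOA w).vac ⊗ₜ (A.comVOA hA (A.VA w) (A.conf - A.confOf w) hω).vac) = A.vac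
    rw [he]
    exact hA.creation A.vac
  map_conf := by
    change e ((A.VAVOA w).conf ⊗ₜ (A.comVOA hA (A.VA w) (A.conf - A.confOf w) hω).vac +
      (A.VAVOA w).vac ⊗ₜ (A.comVOA hA (A.VA w) (A.conf - A.confOf w) hω).conf) = A.conf
    rw [map_add, he, he]
    change mode A.Y (-1) (A.confOf w) A.vac + mode A.Y (-1) A.vac (A.conf - A.confOf w) = A.conf
    have : mode A.Y (-1) A.vac (A.conf - A.confOf w) =
      if (-1 : ℤ) = -1 then A.conf - A.confOf w else 0 := hA.vacuum _ _
    rw [hA.creation, this, if_pos rfl]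
    abel
  map_mode n x y := by
    induction x with
    | zero => simp
    | add x x' hx hx' =>
      rw [map_add, LinearMap.add_apply, map_add, hx, hx', map_add, map_add, LinearMap.add_apply]
    | tmul a b =>
      induction y with
      | zero => simp
      | add y y' hy hy' => rw [map_add, map_add, hy, hy', map_add, map_add]
      | tmul c d =>
        rw [mode_tensor_tmul, he, he, mode_tensor_map hA a.2 b.2 c.2 d.2]
        have h1 := fun (f : ℤ → A.VA w ⊗[ℂ] A.commutant (A.VA w)) =>
          AddMonoidHom.map_finsum_of_injective e.toLinearMap.toAddMonoidHom e.injective f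
        refine (h1 _).trans (finsum_congr fun i => ?_)
        change e _ = _
        rw [he, mode_VAVOA, mode_comVOA]

end PreVOA

open Finset.HasAntidiagonal (antidiagonal)

/-! ### Sums over antidiagonals -/

section Sums

variable {E : Type*} [AddCommGroup E]

theorem sum_antidiagonal_assoc (F : ℕ → ℕ → ℕ → E) (t : ℕ) :
    ∑ p ∈ antidiagonal t, ∑ q ∈ antidiagonal p.2, F p.1 q.1 q.2 =
      ∑ p ∈ antidiagonal t, ∑ q ∈ antidiagonal p.1, F q.1 q.2 p.2 := by
  rw [Finset.sum_sigma', Finset.sum_sigma']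
  refine Finset.sum_nbij' (fun x => ⟨(x.1.1 + x.2.1, x.2.2), (x.1.1, x.2.1)⟩)
    (fun x => ⟨(x.2.1, x.2.2 + x.1.2), (x.2.2, x.1.2)⟩) ?_ ?_ ?_ ?_ ?_
  · rintro ⟨⟨a, b⟩, ⟨c, d⟩⟩ h
    simp only [Finset.mem_sigma, Finset.HasAntidiagonal.mem_antidiagonal] at h ⊢
    grind
  · rintro ⟨⟨a, b⟩, ⟨c, d⟩⟩ h
    simp only [Finset.mem_sigma, Finset.HasAntidiagonal.mem_antidiagonal] at h ⊢
    grind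
  · rintro ⟨⟨a, b⟩, ⟨c, d⟩⟩ h
    simp only [Finset.mem_sigma, Finset.HasAntidiagonal.mem_antidiagonal] at h ⊢
    obtain ⟨-, rfl⟩ := h
    rfl
  · rintro ⟨⟨a, b⟩, ⟨c, d⟩⟩ h
    simp only [Finset.mem_sigma, Finset.HasAntidiagonal.mem_antidiagonal] at h ⊢
    obtain ⟨-, rfl⟩ := h
    rfl
  · rintro ⟨⟨a, b⟩, ⟨c, d⟩⟩ h
    rfl

theorem sum_antidiagonal_left_comm (F : ℕ → ℕ → ℕ → E) (t : ℕ) :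
    ∑ p ∈ antidiagonal t, ∑ q ∈ antidiagonal p.2, F p.1 q.1 q.2 =
      ∑ p ∈ antidiagonal t, ∑ q ∈ antidiagonal p.2, F q.1 p.1 q.2 := by
  rw [sum_antidiagonal_assoc, sum_antidiagonal_assoc (fun a b c => F b a c)]
  refine Finset.sum_congr rfl fun p _ => ?_
  exact (Finset.Nat.sum_antidiagonal_swap (f := fun q : ℕ × ℕ => F q.1 q.2 p.2)).symm

theorem finsum_antidiagonal {f : ℕ → ℕ → E} {B C : ℕ}
    (hf : ∀ a b, B ≤ a ∨ C ≤ b → f a b = 0) :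
    ∑ᶠ t, ∑ p ∈ antidiagonal t, f p.1 p.2 = ∑ a ∈ Finset.range B, ∑ᶠ b, f a b := by
  have h1 : ∀ a, ∑ᶠ b, f a b = ∑ b ∈ Finset.range C, f a b := fun a =>
    finsum_eq_sum_of_support_subset _ fun b hb => by
      by_contra h
      exact hb (hf a b (Or.inr (by simpa using h)))
  simp only [h1]
  rw [← Finset.sum_product', finsum_eq_sum_of_support_subset (s := Finset.range (B + C)),
    ← Finset.sum_fiberwise_of_maps_to (s := Finset.range B ×ˢ Finset.range C)
      (t := Finset.range (B + C)) (g := fun p => p.1 + p.2)]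
  · refine Finset.sum_congr rfl fun t _ => ?_
    symm
    refine Finset.sum_subset (fun p hp => ?_) fun p hp hp' => ?_
    · simpa using (Finset.mem_filter.1 hp).2
    · refine hf _ _ ?_
      by_contra! h
      refine hp' (Finset.mem_filter.2 ⟨?_, by simpa using hp⟩)
      simpa using h
  · intro p hp
    simp only [Finset.mem_product, Finset.mem_range] at hp ⊢
    omega
  · intro t ht
    by_contra h
    refine ht (Finset.sum_eq_zero fun p hp => hf _ _ ?_)
    simp only [Finset.coe_range, Set.mem_Iio, not_lt, Finset.HasAntidiagonal.mem_antidiagonal] at h hp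
    omega

end Sums

/-! ### Binomial identities -/

theorem choose_neg_succ (e r : ℕ) :
    Ring.choose (-((e : ℤ) + 1)) r = (-1) ^ r * ((e + r).choose e : ℤ) := by
  rw [Ring.choose_neg, show (e : ℤ) + 1 + r - 1 = ((e + r : ℕ) : ℤ) by push_cast; ring,
    Ring.choose_natCast, Nat.choose_symm_add, Units.smul_def, Int.coe_negOnePow_natCast]
  rfl

/-- The coefficient form of z∂_z (z+z₀)^{-d} = -d z (z+z₀)^{-d-1}. -/
theorem mul_choose_neg_sub_one (d r : ℕ) :
    (d : ℤ) * Ring.choose (-(d : ℤ) - 1) r = ((d : ℤ) + r) * Ring.choose (-(d : ℤ)) r := by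
  rcases d with _ | e
  · rcases r with _ | r
    · simp
    · simp [Ring.choose_zero_succ]
  · rw [show (-((e + 1 : ℕ) : ℤ) - 1) = -(((e + 1 : ℕ) : ℤ) + 1) by ring, choose_neg_succ,
      show (-((e + 1 : ℕ) : ℤ)) = -((e : ℤ) + 1) by push_cast; ring, choose_neg_succ]
    have h := Nat.add_one_mul_choose_eq (e + r) e
    have h2 : ((e + r : ℕ) + 1 : ℤ) * ((e + r).choose e : ℤ) =
        ((e + r + 1).choose (e + 1) : ℤ) * (e + 1) := by exact_mod_cast h
    rw [show e + 1 + r = e + r + 1 by ring]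
    push_cast at h2 ⊢
    linear_combination -(-1) ^ r * h2

namespace PreVOA

variable {V : Type*} [AddCommGroup V] [Module ℂ V] {A : PreVOA V} {U : A.UnitaryStructure} {w : V}

/-! ### The deformation operators -/

/-- The logarithmic derivative of the deformation: the signs `(-1)^{k+1}`, `k ≥ 1`. -/
def deformSign (k : ℕ) : ℤ := if k = 0 then 0 else (-1) ^ (k + 1)

/-- Summing z^{-k}z₀^{k-j} with weights (-1)^{k+1}C(k,j) over k ≥ j gives (-1)^{j+1} z
(z+z₀)^{-j-1}; these are its coefficients. For j = 0 it fails, the sign at 0 being set to 0. -/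
theorem deformSign_mul_choose {j : ℕ} (hj : j ≠ 0) (q : ℕ) :
    deformSign (j + q) * ((j + q).choose j : ℤ) =
      deformSign j * Ring.choose (-(j : ℤ) - 1) q := by
  rw [deformSign, deformSign, if_neg (by omega), if_neg hj,
    show -(j : ℤ) - 1 = -((j : ℤ) + 1) by ring, choose_neg_succ]
  ring

/-- Li's operators: the coefficients of
`Δ(z) = exp (∑_{k ≥ 1} (-1)^{k+1} w_k z^{-k} / k)`. -/
def deform (A : PreVOA V) (w : V) : ℕ → Module.End ℂ V
  | 0 => 1
  | t + 1 => ((t : ℂ) + 1)⁻¹ • ∑ k : Fin (t + 1),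
      deformSign (k + 1) • (mode A.Y ((k : ℕ) + 1) w * deform A w (t - k))

theorem deform_zero (x : V) : A.deform w 0 x = x := by
  rw [deform]
  rfl

/-- This is -z∂_z applied to the exponential. All later arguments use this recursion, never the
exponential series. -/
theorem deform_rec (t : ℕ) (x : V) :
    (t : ℂ) • A.deform w t x =
      ∑ p ∈ antidiagonal t, deformSign p.1 • mode A.Y p.1 w (A.deform w p.2 x) := by
  rcases t with _ | t
  · simp [deformSign]
  · rw [deform, LinearMap.smul_apply, smul_smul]
    push_cast
    rw [mul_inv_cancel₀ (Nat.cast_add_one_ne_zero t), one_smul, Finset.Nat.sum_antidiagonal_succ,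
      deformSign, if_pos rfl, zero_smul, zero_add, Finset.sum_apply,
      Finset.Nat.sum_antidiagonal_eq_sum_range_succ
        (fun i j => deformSign (i + 1) • mode A.Y ((i + 1 : ℕ) : ℤ) w (A.deform w j x)),
      ← Fin.sum_univ_eq_sum_range (fun i => deformSign (i + 1) •
        mode A.Y ((i + 1 : ℕ) : ℤ) w (A.deform w (t - i) x))]
    refine Finset.sum_congr rfl fun k _ => ?_
    push_cast
    rfl

theorem IsBoson.deform_mem_weight (hw : A.IsBoson U w) (hA : A.IsVOA) {n : ℤ} {a : V}
    (ha : a ∈ A.weight n) (t : ℕ) : A.deform w t a ∈ A.weight (n - t) := by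
  induction t using Nat.strong_induction_on with
  | _ t ih =>
    rcases t with _ | t
    · rw [deform_zero]
      simpa using ha
    · refine (Submodule.smul_mem_iff _ (s := ((t + 1 : ℕ) : ℂ)) (Nat.cast_ne_zero.2 (by omega))).1 ?_
      rw [deform_rec]
      refine Submodule.sum_mem _ fun p hp => ?_
      rw [Finset.HasAntidiagonal.mem_antidiagonal] at hp
      by_cases h0 : p.1 = 0
      · rw [h0, deformSign, if_pos rfl, zero_smul]
        exact zero_mem _
      · refine zsmul_mem ?_ _
        have := hA.mode_mem_weight hw.mem_weight (ih p.2 (by omega)) p.1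
        rwa [show 1 + (n - p.2) - p.1 - 1 = n - ((t + 1 : ℕ) : ℤ) by omega] at this

theorem IsBoson.exists_deform_eq_zero (hw : A.IsBoson U w) (hA : A.IsVOA) (hcft : A.IsCFTType)
    (a : V) : ∃ D : ℕ, ∀ d, D ≤ d → A.deform w d a = 0 := by
  refine hA.weight_induction (P := fun a => ∃ D : ℕ, ∀ d, D ≤ d → A.deform w d a = 0) ?_ ?_ a
  · intro n a ha
    exact ⟨(n + 1).toNat, fun d hd =>
      hcft.eq_zero_of_neg (by omega) (hw.deform_mem_weight hA ha d)⟩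
  · rintro a b ⟨D, hD⟩ ⟨D', hD'⟩
    refine ⟨max D D', fun d hd => ?_⟩
    rw [map_add, hD d (by omega), hD' d (by omega), add_zero]

/-- The generating function `g(z + z₀)` of the commutators of `w` with a field. -/
theorem IsBoson.sum_commutator (hw : A.IsBoson U w) (hA : A.IsVOA) (d R : ℕ) (l : ℤ) (a b : V) :
    ∑ p ∈ antidiagonal R, (deformSign p.1 * Ring.choose (-(d : ℤ)) p.2) •
      (mode A.Y p.1 w (mode A.Y (l + p.2) a b) - mode A.Y (l + p.2) a (mode A.Y p.1 w b)) =
    ∑ p ∈ antidiagonal R, (deformSign p.1 * Ring.choose (-((d + p.1 : ℕ) : ℤ) - 1) p.2) •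
      mode A.Y (l + p.2) (mode A.Y p.1 w a) b := by
  have h1 : ∀ p : ℕ × ℕ, (deformSign p.1 * Ring.choose (-(d : ℤ)) p.2) •
      (mode A.Y p.1 w (mode A.Y (l + p.2) a b) - mode A.Y (l + p.2) a (mode A.Y p.1 w b)) =
      ∑ q ∈ antidiagonal p.1, (deformSign (q.1 + q.2) * Ring.choose (-(d : ℤ)) p.2 *
        ((q.1 + q.2).choose q.1 : ℤ)) •
          mode A.Y (l + (q.2 + p.2 : ℕ)) (mode A.Y q.1 w a) b := by
    intro p
    rw [hA.isModule.commutator_nat, ← Finset.Nat.sum_antidiagonal_eq_sum_range_succ_mk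
      (fun q : ℕ × ℕ => p.1.choose q.1 •
        mode A.Y (p.1 + (l + p.2) - q.1) (mode A.Y q.1 w a) b), Finset.smul_sum]
    refine Finset.sum_congr rfl fun q hq => ?_
    rw [Finset.HasAntidiagonal.mem_antidiagonal] at hq
    rw [hq, mul_smul _ ((p.1.choose q.1 : ℕ) : ℤ), natCast_zsmul,
      show (p.1 : ℤ) + (l + p.2) - q.1 = l + (q.2 + p.2 : ℕ) by push_cast; omega]
  rw [Finset.sum_congr rfl fun p _ => h1 p, ← sum_antidiagonal_assoc (fun j q r =>
    (deformSign (j + q) * Ring.choose (-(d : ℤ)) r * ((j + q).choose j : ℤ)) •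
      mode A.Y (l + (q + r : ℕ)) (mode A.Y j w a) b)]
  refine Finset.sum_congr rfl fun p _ => ?_
  -- The sign identity needs a positive index; the index 0 term drops out since w_0 = 0. The
  -- remaining case is Vandermonde for (z+z₀)^{-j-1}(z+z₀)^{-d}.
  by_cases h0 : p.1 = 0
  · have h2 : mode A.Y (p.1 : ℕ) w a = 0 := by rw [h0]; exact hw.zero_mode a
    simp [h2]
  · rw [show -((d + p.1 : ℕ) : ℤ) - 1 = (-(p.1 : ℤ) - 1) + -(d : ℤ) by push_cast; ring,
      Ring.add_choose_eq _ (Commute.all _ _), Finset.mul_sum, Finset.sum_smul]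
    refine Finset.sum_congr rfl fun q hq => ?_
    rw [Finset.HasAntidiagonal.mem_antidiagonal] at hq
    rw [hq, mul_right_comm, deformSign_mul_choose h0]
    congr 1
    ring

/-- `Δ(z) Y(a, z₀) b = Y(Δ(z + z₀) a, z₀) Δ(z) b`. -/
theorem IsBoson.deform_mode (hw : A.IsBoson U w) (hA : A.IsVOA) (t : ℕ) (l : ℤ) (a b : V) :
    A.deform w t (mode A.Y l a b) =
      ∑ p ∈ antidiagonal t, ∑ q ∈ antidiagonal p.2, Ring.choose (-(p.1 : ℤ)) q.2 •
        mode A.Y (l + q.2) (A.deform w p.1 a) (A.deform w q.1 b) := by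
  induction t using Nat.strong_induction_on with
  | _ t ih =>
    rcases Nat.eq_zero_or_pos t with rfl | ht
    · simp [deform_zero]
    -- Multiplying by t amounts to applying -z∂_z, so the recursion becomes available.
    refine smul_right_injective V (r := (t : ℂ)) (Nat.cast_ne_zero.2 ht.ne') ?_
    dsimp only
    have h1 : (t : ℂ) • A.deform w t (mode A.Y l a b) =
        ∑ p ∈ antidiagonal t, ∑ q ∈ antidiagonal p.2, ∑ r ∈ antidiagonal q.2,
          (deformSign p.1 * Ring.choose (-(q.1 : ℤ)) r.2) • mode A.Y p.1 w
            (mode A.Y (l + r.2) (A.deform w q.1 a) (A.deform w r.1 b)) := by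
      rw [deform_rec]
      refine Finset.sum_congr rfl fun p hp => ?_
      rw [Finset.HasAntidiagonal.mem_antidiagonal] at hp
      by_cases h0 : p.1 = 0
      · rw [h0, deformSign, if_pos rfl]
        simp
      · rw [ih p.2 (by omega), map_sum, Finset.smul_sum]
        refine Finset.sum_congr rfl fun q _ => ?_
        rw [map_sum, Finset.smul_sum]
        refine Finset.sum_congr rfl fun r _ => ?_
        rw [map_zsmul, smul_smul]
    rw [h1, sum_antidiagonal_left_comm (fun k d m => ∑ r ∈ antidiagonal m,
      (deformSign k * Ring.choose (-(d : ℤ)) r.2) • mode A.Y k w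
        (mode A.Y (l + r.2) (A.deform w d a) (A.deform w r.1 b)))]
    -- Move w_k through the field: the commutator acts on the first argument, and the rest
    -- reassembles, by the recursion, to a factor e on the component Δ_e b.
    have h2 : ∀ p : ℕ × ℕ, (∑ q ∈ antidiagonal p.2, ∑ r ∈ antidiagonal q.2,
        (deformSign q.1 * Ring.choose (-(p.1 : ℤ)) r.2) • mode A.Y q.1 w
          (mode A.Y (l + r.2) (A.deform w p.1 a) (A.deform w r.1 b))) =
        (∑ q ∈ antidiagonal p.2, ∑ r ∈ antidiagonal q.2,
          (deformSign q.1 * Ring.choose (-((p.1 + q.1 : ℕ) : ℤ) - 1) r.2) •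
            mode A.Y (l + r.2) (mode A.Y q.1 w (A.deform w p.1 a)) (A.deform w r.1 b)) +
        ∑ q ∈ antidiagonal p.2, (q.1 : ℂ) • (Ring.choose (-(p.1 : ℤ)) q.2) •
          mode A.Y (l + q.2) (A.deform w p.1 a) (A.deform w q.1 b) := by
      intro p
      have h3 : ∑ q ∈ antidiagonal p.2, (q.1 : ℂ) • (Ring.choose (-(p.1 : ℤ)) q.2) •
          mode A.Y (l + q.2) (A.deform w p.1 a) (A.deform w q.1 b) =
          ∑ q ∈ antidiagonal p.2, ∑ r ∈ antidiagonal q.2,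
            (deformSign r.1 * Ring.choose (-(p.1 : ℤ)) r.2) •
              mode A.Y (l + r.2) (A.deform w p.1 a) (mode A.Y r.1 w (A.deform w q.1 b)) := by
        rw [sum_antidiagonal_assoc (fun e k r => (deformSign k * Ring.choose (-(p.1 : ℤ)) r) •
          mode A.Y (l + r) (A.deform w p.1 a) (mode A.Y k w (A.deform w e b)))]
        refine Finset.sum_congr rfl fun q _ => ?_
        rw [smul_comm, ← map_smul, deform_rec, map_sum, Finset.smul_sum,
          ← Finset.Nat.sum_antidiagonal_swap]
        refine Finset.sum_congr rfl fun r _ => ?_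
        rw [map_zsmul, smul_smul, mul_comm]
        rfl
      rw [h3, sum_antidiagonal_left_comm (fun k e r =>
          (deformSign k * Ring.choose (-(p.1 : ℤ)) r) • mode A.Y k w
            (mode A.Y (l + r) (A.deform w p.1 a) (A.deform w e b))),
        sum_antidiagonal_left_comm (fun j e r =>
          (deformSign j * Ring.choose (-((p.1 + j : ℕ) : ℤ) - 1) r) •
            mode A.Y (l + r) (mode A.Y j w (A.deform w p.1 a)) (A.deform w e b)),
        ← Finset.sum_add_distrib]
      refine Finset.sum_congr rfl fun q _ => ?_
      rw [← hw.sum_commutator hA, ← Finset.sum_add_distrib]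
      refine Finset.sum_congr rfl fun r _ => ?_
      rw [← smul_add, sub_add_cancel]
    rw [Finset.sum_congr rfl fun p _ => h2 p, Finset.sum_add_distrib,
      sum_antidiagonal_assoc (fun d j s => ∑ r ∈ antidiagonal s,
        (deformSign j * Ring.choose (-((d + j : ℕ) : ℤ) - 1) r.2) •
          mode A.Y (l + r.2) (mode A.Y j w (A.deform w d a)) (A.deform w r.1 b)),
      ← Finset.sum_add_distrib, Finset.smul_sum]
    refine Finset.sum_congr rfl fun p hp => ?_
    rw [Finset.sum_comm, ← Finset.sum_add_distrib, Finset.smul_sum]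
    refine Finset.sum_congr rfl fun q hq => ?_
    have h4 : ∑ r ∈ antidiagonal p.1, (deformSign r.2 *
        Ring.choose (-((r.1 + r.2 : ℕ) : ℤ) - 1) q.2) •
          mode A.Y (l + q.2) (mode A.Y r.2 w (A.deform w r.1 a)) (A.deform w q.1 b) =
        ((p.1 : ℤ) * Ring.choose (-(p.1 : ℤ) - 1) q.2) •
          mode A.Y (l + q.2) (A.deform w p.1 a) (A.deform w q.1 b) := by
      have h5 : (p.1 : ℂ) • mode A.Y (l + q.2) (A.deform w p.1 a) (A.deform w q.1 b) =
          ∑ r ∈ antidiagonal p.1, deformSign r.2 •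
            mode A.Y (l + q.2) (mode A.Y r.2 w (A.deform w r.1 a)) (A.deform w q.1 b) := by
        rw [← LinearMap.smul_apply, ← map_smul, deform_rec, map_sum, LinearMap.sum_apply,
          ← Finset.Nat.sum_antidiagonal_swap]
        refine Finset.sum_congr rfl fun r _ => ?_
        rw [map_zsmul, LinearMap.smul_apply]
        rfl
      rw [mul_comm, mul_smul, ← Int.cast_smul_eq_zsmul ℂ (p.1 : ℤ), Int.cast_natCast, h5,
        Finset.smul_sum]
      refine Finset.sum_congr rfl fun r hr => ?_
      rw [Finset.HasAntidiagonal.mem_antidiagonal] at hr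
      rw [smul_smul, mul_comm, hr]
    -- The two contributions add up to (d + r)C(-d,r) + e C(-d,r), which is t C(-d,r) as d + e + r =
    -- t.
    rw [h4, mul_choose_neg_sub_one, ← Int.cast_smul_eq_zsmul ℂ, ← Int.cast_smul_eq_zsmul ℂ,
      smul_smul, smul_smul, ← add_smul]
    congr 1
    rw [Finset.HasAntidiagonal.mem_antidiagonal] at hp hq
    have h5 : (t : ℂ) = p.1 + (q.1 + q.2) := by
      rw [← hp, ← hq]
      push_cast
      ring
    rw [h5]
    push_cast
    ring

/-! ### The deformed module -/

theorem deform_finite (A : PreVOA V) {w : V}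
    (h : ∀ a, ∃ D : ℕ, ∀ d, D ≤ d → A.deform w d a = 0) (n : ℤ) (a x : V) :
    (Function.support fun d : ℕ => (mode A.Y (n - d) ∘ₗ A.deform w d) a x).Finite := by
  obtain ⟨D, hD⟩ := h a
  refine (Set.finite_Iio D).subset fun d hd => ?_
  by_contra hcon
  refine hd ?_
  simp [hD d (by simpa using hcon)]

/-- The field `Y(Δ(z) a, z)`. -/
def deformedY (A : PreVOA V) (w : V)
    (h : ∀ a, ∃ D : ℕ, ∀ d, D ≤ d → A.deform w d a = 0) : V →ₗ[ℂ] VertexOperator ℂ V :=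
  ofModes (fun n => sumBilin (fun d : ℕ => mode A.Y (n - d) ∘ₗ A.deform w d) (deform_finite A h n))
    (fun a x => by
      obtain ⟨D, hD⟩ := h a
      choose N hN using fun d : ℕ => mode_truncation A.Y (A.deform w d a) x
      obtain ⟨C, hC⟩ := ((Finset.range D).image fun d : ℕ => N d + d).bddAbove
      refine ⟨C, fun n hn => finsum_eq_zero_of_forall_eq_zero fun d => ?_⟩
      by_cases hd : d < D
      · have := hC (Finset.mem_coe.2 (Finset.mem_image_of_mem _ (Finset.mem_range.2 hd)))
        exact hN d _ (by omega)
      · simp [hD d (by omega)])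

variable {h : ∀ a, ∃ D : ℕ, ∀ d, D ≤ d → A.deform w d a = 0}

theorem mode_deformedY {D : ℕ} {a : V} (hD : ∀ d, D ≤ d → A.deform w d a = 0) (n : ℤ) (x : V) :
    mode (A.deformedY w h) n a x =
      ∑ d ∈ Finset.range D, mode A.Y (n - d) (A.deform w d a) x := by
  rw [deformedY, mode_ofModes]
  change ∑ᶠ d : ℕ, mode A.Y (n - d) (A.deform w d a) x = _
  refine finsum_eq_sum_of_support_subset _ fun d hd => ?_
  by_contra hcon
  refine hd ?_
  simp [hD d (by simpa using hcon)]

theorem IsBoson.mode_deformedY_mode (hw : A.IsBoson U w) (hA : A.IsVOA) {D E : ℕ} {a b : V}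
    (hD : ∀ d, D ≤ d → A.deform w d a = 0) (hE : ∀ d, E ≤ d → A.deform w d b = 0)
    (p q : ℤ) (x : V) :
    mode (A.deformedY w h) p (mode A.Y q a b) x =
      ∑ d ∈ Finset.range D, ∑ e ∈ Finset.range E, ∑ᶠ r : ℕ, Ring.choose (-(d : ℤ)) r •
        mode A.Y (p - d - e - r) (mode A.Y (q + r) (A.deform w d a) (A.deform w e b)) x := by
  choose N hN using fun d e : ℕ => mode_truncation A.Y (A.deform w d a) (A.deform w e b)
  obtain ⟨C, hC⟩ := ((Finset.range D ×ˢ Finset.range E).image fun p => (N p.1 p.2 - q)).bddAbove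
  have hzero : ∀ d e r : ℕ, D ≤ d ∨ E ≤ e ∨ C.toNat ≤ r →
      mode A.Y (q + r) (A.deform w d a) (A.deform w e b) = 0 := by
    intro d e r hder
    by_cases hd : D ≤ d
    · simp [hD d hd]
    by_cases he : E ≤ e
    · simp [hE e he]
    refine hN d e _ ?_
    have := hC (Finset.mem_coe.2 (Finset.mem_image_of_mem (a := (d, e))
      (fun p : ℕ × ℕ => (N p.1 p.2 - q)) (Finset.mem_product.2 ⟨Finset.mem_range.2 (not_le.1 hd), Finset.mem_range.2 (not_le.1 he)⟩)))
    simp only at this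
    omega
  have hzero' : ∀ d e r : ℕ, D ≤ d ∨ E ≤ e ∨ C.toNat ≤ r → Ring.choose (-(d : ℤ)) r •
      mode A.Y (p - d - e - r) (mode A.Y (q + r) (A.deform w d a) (A.deform w e b)) x = 0 :=
    fun d e r hder => by simp [hzero d e r hder]
  have h1 : mode (A.deformedY w h) p (mode A.Y q a b) x =
      ∑ᶠ t : ℕ, ∑ y ∈ antidiagonal t, ∑ z ∈ antidiagonal y.2, Ring.choose (-(y.1 : ℤ)) z.2 •
        mode A.Y (p - y.1 - z.1 - z.2)
          (mode A.Y (q + z.2) (A.deform w y.1 a) (A.deform w z.1 b)) x := by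
    rw [deformedY, mode_ofModes]
    refine finsum_congr fun t => ?_
    change mode A.Y (p - t) (A.deform w t (mode A.Y q a b)) x = _
    rw [hw.deform_mode hA, map_sum, LinearMap.sum_apply]
    refine Finset.sum_congr rfl fun y hy => ?_
    rw [map_sum, LinearMap.sum_apply]
    refine Finset.sum_congr rfl fun z hz => ?_
    rw [Finset.HasAntidiagonal.mem_antidiagonal] at hy hz
    rw [map_zsmul, LinearMap.smul_apply,
      show p - (y.1 : ℤ) - z.1 - z.2 = p - t by omega]
  rw [h1, finsum_antidiagonal (f := fun d u => ∑ z ∈ antidiagonal u, Ring.choose (-(d : ℤ)) z.2 •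
    mode A.Y (p - d - z.1 - z.2) (mode A.Y (q + z.2) (A.deform w d a) (A.deform w z.1 b)) x)
    (B := D) (C := E + C.toNat)]
  · refine Finset.sum_congr rfl fun d _ => ?_
    exact finsum_antidiagonal (f := fun e r => Ring.choose (-(d : ℤ)) r •
      mode A.Y (p - d - e - r) (mode A.Y (q + r) (A.deform w d a) (A.deform w e b)) x)
      (B := E) (C := C.toNat) fun e r her => hzero' d e r (Or.inr her)
  · intro d u hdu
    refine Finset.sum_eq_zero fun z hz => hzero' _ _ _ ?_
    rw [Finset.HasAntidiagonal.mem_antidiagonal] at hz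
    omega

theorem borcherds_right_finite {M : Type*} [AddCommGroup M] [Module ℂ M]
    (Y : V →ₗ[ℂ] VertexOperator ℂ M) (a b : V) (x : M) (l m n : ℤ) :
    (Function.support fun i : ℕ => ((-1) ^ i * Ring.choose l i) •
      (mode Y (m + l - i) a (mode Y (n + i) b x) -
        ((Int.negOnePow l : ℤˣ) : ℤ) • mode Y (n + l - i) b (mode Y (m + i) a x))).Finite := by
  obtain ⟨N, hN⟩ := mode_truncation Y b x
  obtain ⟨N', hN'⟩ := mode_truncation Y a x
  refine (Set.finite_Iio (max (N - n) (N' - m)).toNat).subset fun i hi => ?_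
  by_contra hcon
  rw [Set.mem_Iio] at hcon
  refine hi ?_
  simp only [hN (n + i) (by omega), hN' (m + i) (by omega)]
  simp

theorem finsum_choose_mul_choose {E : Type*} [AddCommGroup E] (m d : ℤ) {H : ℕ → E} {C : ℕ}
    (hH : ∀ s, C ≤ s → H s = 0) :
    ∑ᶠ i : ℕ, ∑ᶠ r : ℕ, (Ring.choose m i * Ring.choose d r) • H (i + r) =
      ∑ᶠ s : ℕ, Ring.choose (m + d) s • H s := by
  have hz : ∀ i r, C ≤ i ∨ C ≤ r → (Ring.choose m i * Ring.choose d r) • H (i + r) = 0 :=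
    fun i r hir => by rw [hH _ (by omega), smul_zero]
  rw [finsum_eq_sum_of_support_subset (s := Finset.range C), ← finsum_antidiagonal hz]
  · refine finsum_congr fun s => ?_
    rw [Ring.add_choose_eq _ (Commute.all _ _), Finset.sum_smul]
    refine Finset.sum_congr rfl fun p hp => ?_
    rw [Finset.HasAntidiagonal.mem_antidiagonal] at hp
    rw [hp]
  · intro i hi
    by_contra hcon
    exact hi (finsum_eq_zero_of_forall_eq_zero fun r => hz i r (Or.inl (by simpa using hcon)))

/-- For each pair of components Δ_d a, Δ_e b this is the Borcherds identity of V at (l, m - d, n -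
e). The factor C(-d,r) from `IsBoson.deform_mode` merges with C(m,i) into C(m - d, i + r) by
Vandermonde. -/
theorem IsBoson.borcherds_deformedY (hw : A.IsBoson U w) (hA : A.IsVOA) :
    A.Borcherds (A.deformedY w h) := by
  intro a b x l m n
  obtain ⟨D, hD⟩ := h a
  obtain ⟨E, hE⟩ := h b
  have hR : ∑ᶠ i : ℕ, ((-1) ^ i * Ring.choose l i) •
      (mode (A.deformedY w h) (m + l - i) a (mode (A.deformedY w h) (n + i) b x) -
        ((Int.negOnePow l : ℤˣ) : ℤ) •
          mode (A.deformedY w h) (n + l - i) b (mode (A.deformedY w h) (m + i) a x)) =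
      ∑ d ∈ Finset.range D, ∑ e ∈ Finset.range E, ∑ᶠ i : ℕ, ((-1) ^ i * Ring.choose l i) •
        (mode A.Y (m - d + l - i) (A.deform w d a) (mode A.Y (n - e + i) (A.deform w e b) x) -
          ((Int.negOnePow l : ℤˣ) : ℤ) •
            mode A.Y (n - e + l - i) (A.deform w e b)
              (mode A.Y (m - d + i) (A.deform w d a) x)) := by
    simp only [← finsum_sum_comm _ _ fun e _ => borcherds_right_finite A.Y _ (A.deform w e b) x l
      _ (n - (e : ℤ))]
    rw [← finsum_sum_comm]
    · refine finsum_congr fun i => ?_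
      simp only [mode_deformedY hD, mode_deformedY hE, map_sum]
      rw [Finset.sum_comm (s := Finset.range E)]
      simp only [Finset.smul_sum, ← Finset.sum_sub_distrib]
      refine Finset.sum_congr rfl fun d _ => Finset.sum_congr rfl fun e _ => ?_
      rw [show m + l - i - d = m - d + l - i by ring, show n + i - (e : ℤ) = n - e + i by ring,
        show n + l - i - (e : ℤ) = n - e + l - i by ring, show m + i - (d : ℤ) = m - d + i by ring]
    · intro d _
      refine Set.Finite.subset (Finset.finite_toSet ((Finset.range E).biUnion fun e =>
        (borcherds_right_finite A.Y (A.deform w d a) (A.deform w e b) x l (m - d)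
          (n - e)).toFinset)) fun i hi => ?_
      obtain ⟨e, he, hne⟩ := Finset.exists_ne_zero_of_sum_ne_zero hi
      exact Finset.mem_coe.2 (Finset.mem_biUnion.2 ⟨e, he, by simpa using hne⟩)
  rw [hR]
  simp only [hw.mode_deformedY_mode hA hD hE, Finset.smul_sum]
  have hfin : ∀ d e : ℕ, ∃ C : ℕ, ∀ s : ℕ, C ≤ s → mode A.Y (m + n - d - e - s)
      (mode A.Y (l + s) (A.deform w d a) (A.deform w e b)) x = 0 := by
    intro d e
    obtain ⟨N, hN⟩ := mode_truncation A.Y (A.deform w d a) (A.deform w e b)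
    refine ⟨(N - l).toNat, fun s hs => ?_⟩
    rw [hN _ (by omega)]
    simp
  have hterm : ∀ (d e i : ℕ), Ring.choose m i • ∑ᶠ r : ℕ, Ring.choose (-(d : ℤ)) r •
      mode A.Y (m + n - i - d - e - r)
        (mode A.Y (l + i + r) (A.deform w d a) (A.deform w e b)) x =
      ∑ᶠ r : ℕ, (Ring.choose m i * Ring.choose (-(d : ℤ)) r) •
        mode A.Y (m + n - d - e - (i + r : ℕ))
          (mode A.Y (l + (i + r : ℕ)) (A.deform w d a) (A.deform w e b)) x := by
    intro d e i
    rw [smul_finsum' _ ?_]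
    · refine finsum_congr fun r => ?_
      rw [smul_smul, show m + n - i - d - e - (r : ℤ) = m + n - d - e - (i + r : ℕ) by
        push_cast; ring, show l + i + (r : ℤ) = l + (i + r : ℕ) by push_cast; ring]
    · obtain ⟨C, hC⟩ := hfin d e
      refine (Set.finite_Iio C).subset fun r hr => ?_
      by_contra hcon
      have h1 := hC (i + r) (by rw [Set.mem_Iio] at hcon; omega)
      refine hr ?_
      simp only
      rw [show m + n - i - d - e - (r : ℤ) = m + n - d - e - (i + r : ℕ) by
        push_cast; ring, show l + i + (r : ℤ) = l + (i + r : ℕ) by push_cast; ring, h1, smul_zero]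
  simp only [hterm]
  have hfin2 : ∀ d e : ℕ, (Function.support fun i : ℕ => ∑ᶠ r : ℕ,
      (Ring.choose m i * Ring.choose (-(d : ℤ)) r) • mode A.Y (m + n - d - e - (i + r : ℕ))
          (mode A.Y (l + (i + r : ℕ)) (A.deform w d a) (A.deform w e b)) x).Finite := by
    intro d e
    obtain ⟨C, hC⟩ := hfin d e
    refine (Set.finite_Iio C).subset fun i hi => ?_
    by_contra hcon
    refine hi (finsum_eq_zero_of_forall_eq_zero fun r => ?_)
    rw [hC (i + r) (by rw [Set.mem_Iio] at hcon; omega), smul_zero]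
  rw [finsum_sum_comm]
  · refine Finset.sum_congr rfl fun d _ => ?_
    rw [finsum_sum_comm _ _ fun e _ => hfin2 d e]
    refine Finset.sum_congr rfl fun e _ => ?_
    obtain ⟨C, hC⟩ := hfin d e
    rw [finsum_choose_mul_choose m (-(d : ℤ)) (H := fun s => mode A.Y (m + n - d - e - s)
      (mode A.Y (l + s) (A.deform w d a) (A.deform w e b)) x) hC]
    refine Eq.trans (finsum_congr fun s => ?_)
      (hA.borcherds (A.deform w d a) (A.deform w e b) x l (m - d) (n - e))
    rw [show m + n - d - e - (s : ℤ) = m - d + (n - e) - s by ring, ← sub_eq_add_neg]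
  · intro d _
    refine Set.Finite.subset (Finset.finite_toSet ((Finset.range E).biUnion fun e =>
      (hfin2 d e).toFinset)) fun i hi => ?_
    obtain ⟨e, he, hne⟩ := Finset.exists_ne_zero_of_sum_ne_zero hi
    exact Finset.mem_coe.2 (Finset.mem_biUnion.2 ⟨e, he, (Set.Finite.mem_toFinset _).2 hne⟩)

theorem IsBoson.isModule_deformedY (hw : A.IsBoson U w) (hA : A.IsVOA) (hcft : A.IsCFTType) :
    A.IsModule (A.deformedY w h) where
  vacuum n x := by
    have hD : ∀ d, 1 ≤ d → A.deform w d A.vac = 0 := fun d hd =>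
      hcft.eq_zero_of_neg (by omega) (hw.deform_mem_weight hA hA.vac_mem_weight d)
    rw [mode_deformedY hD, Finset.sum_range_one, deform_zero]
    simpa using hA.vacuum n x
  borcherds := hw.borcherds_deformedY hA

/-- Δ_d lowers the weight by d and the mode index drops by d as well, so the original grading still
works. -/
theorem IsBoson.isNGradable_deformedY (hw : A.IsBoson U w) (hA : A.IsVOA) (hcft : A.IsCFTType) :
    A.IsNGradable (A.deformedY w h) := by
  refine ⟨A.weight, hcft.weight_neg, hA.grading, fun k m n a ha x hx => ?_⟩
  obtain ⟨D, hD⟩ := h a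
  rw [mode_deformedY hD]
  refine Submodule.sum_mem _ fun d _ => ?_
  have := hA.mode_mem_weight (hw.deform_mem_weight hA ha d) hx (m - d)
  rwa [show k - d + n - (m - d) - 1 = n + k - m - 1 by ring] at this

/-- The deformed mode of a is the original mode plus modes of vectors of lower weight. By induction
on the weight, a submodule of the deformed module is one of V. -/
theorem IsBoson.isSimple_deformedY (hw : A.IsBoson U w) (hA : A.IsVOA) (hcft : A.IsCFTType)
    (hs : IsSimple A.Y) : IsSimple (A.deformedY w h) := by
  refine ⟨hs.1, fun S hS => hs.2 S fun a => ?_⟩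
  have key : ∀ N : ℕ, ∀ k : ℤ, k < N → ∀ a ∈ A.weight k, ∀ (n : ℤ), ∀ x ∈ S,
      mode A.Y n a x ∈ S := by
    intro N
    induction N with
    | zero =>
      intro k hk a ha n x _
      rw [hcft.eq_zero_of_neg (by simpa using hk) ha]
      simp
    | succ N ih =>
      intro k hk a ha n x hx
      obtain ⟨D, hD⟩ := h a
      have h1 := hS a n x hx
      rw [mode_deformedY (D := D + 1) (fun d hd => hD d (by omega)), Finset.sum_range_succ',
        deform_zero] at h1
      simp only [Nat.cast_zero, sub_zero] at h1
      refine (S.add_mem_iff_right (S.sum_mem fun d _ => ?_)).1 h1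
      exact ih _ (by push_cast at hk ⊢; omega) _ (hw.deform_mem_weight hA ha (d + 1)) _ x hx
  refine hA.weight_induction (P := fun a => ∀ (n : ℤ), ∀ x ∈ S, mode A.Y n a x ∈ S) ?_ ?_ a
  · exact fun k a ha => key (k + 1).toNat k (by omega) a ha
  · intro a b ha hb n x hx
    rw [map_add, LinearMap.add_apply]
    exact S.add_mem (ha n x hx) (hb n x hx)

/-- Δ(z)w = w + z^{-1}𝟏, so the deformation shifts w_0 by the identity. -/
theorem IsBoson.zero_mode_deformedY (hw : A.IsBoson U w) (hA : A.IsVOA) (hcft : A.IsCFTType)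
    (x : V) : mode (A.deformedY w h) 0 w x = x := by
  have hD : ∀ d, 2 ≤ d → A.deform w d w = 0 := fun d hd =>
    hcft.eq_zero_of_neg (by omega) (hw.deform_mem_weight hA hw.mem_weight d)
  have h1 : A.deform w 1 w = A.vac := by
    have := deform_rec (A := A) (w := w) 1 w
    simpa [Finset.Nat.sum_antidiagonal_succ, deformSign, deform_zero, hw.one_mode] using this
  have h2 : mode A.Y (-1) A.vac x = if (-1 : ℤ) = -1 then x else 0 := hA.vacuum _ _
  rw [mode_deformedY hD, Finset.sum_range_succ, Finset.sum_range_one, deform_zero, h1]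
  simpa [hw.zero_mode] using h2

theorem IsBoson.not_isHolomorphic (hw : A.IsBoson U w) (hA : A.IsVOA) (hcft : A.IsCFTType) :
    ¬ A.IsHolomorphic := by
  rintro ⟨hs, hall⟩
  have h := hw.exists_deform_eq_zero hA hcft
  obtain ⟨f, hf⟩ := hall V (A.deformedY w h) (hw.isModule_deformedY hA hcft)
    (hw.isNGradable_deformedY hA hcft) (hw.isSimple_deformedY hA hcft hs)
  have h1 := hf w 0 A.vac
  rw [hw.zero_mode_deformedY hA hcft, hw.zero_mode] at h1
  exact hcft.vac_ne_zero (f.map_eq_zero_iff.1 h1)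

end PreVOA

end VOA

end

/-! ### Assembly of the three assertions -/

theorem proposition2 {V : Type*} [AddCommGroup V] [Module ℂ V]
    (A : VOA.PreVOA V) (hA : A.IsVOA) (hcft : A.IsCFTType) (U : A.UnitaryStructure)
    {M : Type*} [AddCommGroup M] [Module ℂ M]
    (Y : V →ₗ[ℂ] VertexOperator ℂ M) (hY : A.IsModule Y)
    (ι : V →ₗ[ℂ] M) (ψ : M →ₗ[ℂ] V)
    (hext : VOA.IsNonsplitExtension A.Y Y A.Y ι ψ) :
    (∃ t : M, A.IsVacuumLift Y ψ t) ∧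
    (∀ t : M, A.IsVacuumLift Y ψ t →
      ∃ u : V, ι u = A.virasoroOn Y (-1) t ∧
        (∃ w : V, A.IsNormalized U u w) ∧
        ∀ w : V, A.IsNormalized U u w →
          A.IsCentral w ∧
          (A.VAVOA w).IsVOA ∧
          (∃ f : A.VA w ≃ₗ[ℂ] VOA.Fock, (A.VAVOA w).IsVOAIso VOA.heisenberg f) ∧
          ∃ hω : A.conf - A.confOf w ∈ A.commutant (A.VA w),
            (A.comVOA hA.toIsVertexAlgebra (A.VA w) (A.conf - A.confOf w) hω).IsVOA ∧
            ∃ e : A.VA w ⊗[ℂ] A.commutant (A.VA w) ≃ₗ[ℂ] V,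
              (∀ (a : A.VA w) (b : A.commutant (A.VA w)),
                e (a ⊗ₜ b) = VOA.mode A.Y (-1) (a : V) (b : V)) ∧
              ((A.VAVOA w).tensor
                (A.comVOA hA.toIsVertexAlgebra (A.VA w) (A.conf - A.confOf w) hω)).IsVOAIso
                  A e) ∧
    ¬ A.IsHolomorphic := by
  have key : ∀ t : M, A.IsVacuumLift Y ψ t → ∃ u : V, ι u = A.virasoroOn Y (-1) t ∧
      (∃ w : V, A.IsNormalized U u w) ∧ ∀ w : V, A.IsNormalized U u w → A.IsBoson U w := by
    intro t ht
    obtain ⟨u, hu, hut⟩ := hext.exists_weight_one hA hcft hY ht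
    have hu0 : u ≠ 0 := by
      rintro rfl
      rw [map_zero] at hut
      exact hext.L_neg_one_lift_ne_zero hA hY ht.2 hut.symm
    exact ⟨u, hut, VOA.PreVOA.exists_isNormalized U hA hcft hu hu0, fun w hw =>
      hw.isBoson hcft hu (hext.zero_mode_eq_zero hA hY ht.2 hut)⟩
  obtain ⟨t₀, ht₀⟩ := hext.exists_isVacuumLift hA
  refine ⟨⟨t₀, ht₀⟩, fun t ht => ?_, ?_⟩
  · obtain ⟨u, hut, hex, hall⟩ := key t ht
    refine ⟨u, hut, hex, fun w hN => ?_⟩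
    have hw := hall w hN
    obtain ⟨f, hf⟩ := hw.exists_fockEquiv hA hcft
    obtain ⟨e, he⟩ := hw.exists_tensorEquiv hA hcft
    have hω := hw.sub_mem_commutant hA hcft
    exact ⟨hw.isCentral, hw.isVOA_VAVOA hA hcft, ⟨f, hw.isVOAIso_heisenberg hA hcft hf⟩, hω,
      hw.isVOA_comVOA hA hcft hω, e, he,
      VOA.PreVOA.isVOAIso_tensor hA.toIsVertexAlgebra hω he⟩
  · obtain ⟨u, -, ⟨w, hN⟩, hall⟩ := key t₀ ht₀
    exact (hall w hN).not_isHolomorphic hA hcft
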